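/- Let $a\in(0,\tfrac12)$, $\alpha=(2(1-2a))^{1/2}$, $\beta=(8a(1-2a))^{1/2}$, and let $$A(t,x)=e^{it}\left[1+\frac{\alpha^2\cosh(\beta t)+i\beta\sinh(\beta t)}{\sqrt{2a}\cos(\alpha x)-\cosh(\beta t)}\right],\qquad t,x\in\mathbb R,$$ be the Akhmediev breather. Let $L=\frac{2\pi k}{\alpha}$ with an integer $k\ge1$ (so that $A(t,\cdot)$ is $L$-periodic; $k=1$ gives the fundamental period), and let $H^s_\sharp$ be the Sobolev space of $L$-periodic functions $f:\mathbb R\to\mathbb C$, with norm $$\|f\|_{H^s_\sharp}^2=\sum_{n\in\mathbb Z}\Big(1+\big(\tfrac{2\pi n}{L}\big)^2\Big)^{s}|\hat f(n)|^2,\qquad \hat f(n)=\frac1L\int_0^L e^{-2\pi i nx/L}f(x)\,dx .$$ Let $s>\frac12$ and $t_0\in\mathbb R$. For an interval $J\ni t_0$, a *solution on $J$* means a function of the form $u=A+w$ with $w\in C(J;H^s_\sharp)$ such that $$i\partial_t u+\partial_x^2u+|u|^2u=0$$ holds at every time $t\in J$ in the sense of $L$-periodic distributions in $x$, that is, for every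 smooth $L$-periodic $\psi:\mathbb R\to\mathbb C$ and every $t\in J$, the function $\tau\mapsto\int_0^L u(\tau,x)\psi(x)\,dx$ is differentiable at $t$ relative to $J$, and $$i\frac{d}{dt}\int_0^L u\,\psi\,dx+\int_0^L u\,\psi''\,dx+\int_0^L|u|^2u\,\psi\,dx=0 .$$ Then this equation is locally well-posed for initial data at time $t_0$ of the form $A(t_0,\cdot)+w_0$, $w_0\in H^s_\sharp$, in the following sense. 1. (Existence.) For every $R>0$ there are $T>0$ and $C>0$, depending only on $a,k,s,t_0,R$, such that for every $w_0\in H^s_\sharp$ with $\|w_0\|_{H^s_\sharp}\le R$ there is a solution $u$ on $[t_0-T,t_0+T]$ with $u(t_0)=A(t_0,\cdot)+w_0$. 2. (Continuous dependence.) With the same $T$ and $C$, if $u,v$ are solutions on $[t_0-T,t_0+T]$ with $\|u(t_0)-A(t_0)\|_{H^s_\sharp}\le R$ and $\|v(t_0)-A(t_0)\|_{H^s_\sharp}\le R$, then $$\|u(t)-v(t)\|_{H^s_\sharp}\le C\,\|u(t_0)-v(t_0)\|_{H^s_\sharp}\qquad\text{for all } t\in[t_0-T,t_0+T].$$ 3.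 (Uniqueness.) If $J$ is any interval containing $t_0$ and $u,v$ are solutions on $J$ with $u(t_0)=v(t_0)$, then $u(t)=v(t)$ for all $t\in J$ (equality almost everywhere in $x$). -/

import Mathlib

open MeasureTheory Filter Set
open scoped Topology ContDiff

namespace NLS

/-- The spatial frequency `α = (2(1-2a))^{1/2}` of the Akhmediev breather. -/
noncomputable def alpha (a : ℝ) : ℝ := Real.sqrt (2 * (1 - 2 * a))

/-- The temporal rate `β = (8a(1-2a))^{1/2}` of the Akhmediev breather. -/
noncomputable def beta (a : ℝ) : ℝ := Real.sqrt (8 * a * (1 - 2 * a))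

/-- The Akhmediev breather `A(t,x)`; for `0 < a < 1/2` the denominator never vanishes. -/
noncomputable def akhmediev (a t x : ℝ) : ℂ :=
  Complex.exp (Complex.I * (t : ℂ)) *
    (1 + (((alpha a) ^ 2 * Real.cosh (beta a * t) : ℝ) +
          Complex.I * ((beta a * Real.sinh (beta a * t) : ℝ) : ℂ)) /
        ((Real.sqrt (2 * a) * Real.cos (alpha a * x) - Real.cosh (beta a * t) : ℝ) : ℂ))

/-- The `n`-th Fourier coefficient of an `L`-periodic function. -/
noncomputable def fourierCoef (L : ℝ) (f : ℝ → ℂ) (n : ℤ) : ℂ :=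
  (1 / (L : ℂ)) *
    ∫ x in (0 : ℝ)..L, Complex.exp (-Complex.I * ((2 * Real.pi * n / L * x : ℝ) : ℂ)) * f x

/-- The `n`-th term of the squared `H^s` norm of an `L`-periodic function. -/
noncomputable def sobolevTerm (L s : ℝ) (f : ℝ → ℂ) (n : ℤ) : ℝ :=
  (1 + (2 * Real.pi * n / L) ^ 2) ^ s * ‖fourierCoef L f n‖ ^ 2

/-- `f` is (a representative of) an element of the periodic Sobolev space `H^s` of period `L`,
for `s ≥ 0`: an `L`-periodic function, square integrable over a period, with finite `H^s` norm. -/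
structure MemHs (L s : ℝ) (f : ℝ → ℂ) : Prop where
  periodic : Function.Periodic f L
  memLp : MemLp f 2 (volume.restrict (Ioc 0 L))
  summable : Summable (sobolevTerm L s f)

/-- The norm of the periodic Sobolev space `H^s` of period `L`. -/
noncomputable def hsNorm (L s : ℝ) (f : ℝ → ℂ) : ℝ :=
  Real.sqrt (∑' n : ℤ, sobolevTerm L s f n)

/-- `u` solves `i u_t + u_xx + |u|² u = 0` at every time of `J`, in the sense of `L`-periodic
distributions in `x` (at an endpoint of `J` the time derivative is one-sided). -/
def SolvesNLSOn (L : ℝ) (J : Set ℝ) (u : ℝ → ℝ → ℂ) : Prop :=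
  ∀ ψ : ℝ → ℂ, ContDiff ℝ ∞ ψ → Function.Periodic ψ L → ∀ t ∈ J,
    ∃ d : ℂ, HasDerivWithinAt (fun τ : ℝ => ∫ x in (0 : ℝ)..L, u τ x * ψ x) d J t ∧
      Complex.I * d + (∫ x in (0 : ℝ)..L, u t x * deriv (deriv ψ) x) +
        (∫ x in (0 : ℝ)..L, (‖u t x‖ ^ 2 : ℝ) * u t x * ψ x) = 0

/-- `u` is a solution of the cubic NLS on the time interval `J` of the form `u = A + w` with
`w ∈ C(J; H^s)`, `A` being the Akhmediev breather of parameter `a`. -/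
structure IsPerturbedSolution (a L s : ℝ) (J : Set ℝ) (u : ℝ → ℝ → ℂ) : Prop where
  memHs : ∀ t ∈ J, MemHs L s (u t - akhmediev a t)
  continuous : ∀ t ∈ J, Tendsto
    (fun τ => hsNorm L s ((u τ - akhmediev a τ) - (u t - akhmediev a t))) (𝓝[J] t) (𝓝 0)
  solves : SolvesNLSOn L J u

end NLS

/-! Multiplying the n-th Fourier coefficient by the Sobolev weight identifies H^s with ℓ²(ℤ). For s
> 1/2 the weight makes H^s an algebra, so u ↦ |u|²u becomes a map `cubic` of ℓ² that is Lipschitz on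
balls (`AlgWeight.exists_norm_mul_le`, `AlgWeight.exists_cubic_lipschitz`). The breather itself is a
continuous curve in H^s, because its Fourier coefficients decay geometrically at a rate uniform in
time (`akhmediev_hasSum`, `exists_breatherSeq`). Hence perturbing A amounts to solving the Cauchy
problem for u itself in H^s; that A solves the equation is never needed.

The unbounded operator ∂_x² disappears in the interaction picture: with ω_n = 2πn/L, the curve
v_n(t) = e^{iω_n²(t-t₀)} u_n(t) satisfies the ODE v' = `field` in ℓ². The phases act isometrically,
so `field` is Lipschitz on balls uniformly in t. Picard–Lindelöf then gives a flow whose lifespan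
depends only on the size of the data (`exists_flow`), and uniqueness for ODEs applies on any compact
interval (`field_unique`).

It remains to match the ODE with the weak equation. From weak to ODE, testing against characters
gives the derivative of each coordinate, and since the candidate derivative is continuous in ℓ²,
this upgrades to a derivative in ℓ² (`SeqL2.hasDerivWithinAt_of_coord`). From ODE to weak, the free
flow is moved onto the smooth test function, where it is differentiable in time
(`solvesNLSOn_of_hasDerivWithinAt`). Every solution is therefore the flow of its datum, which yields
uniqueness and Lipschitz dependence together. -/

namespace NLS

/-! ### Square summable sequences, phase rotations and conjugation -/

/-- The Hilbert space of square summable complex sequences indexed by the integers. -/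
noncomputable abbrev SeqL2 : Type := ↥(lp (fun _ : ℤ => ℂ) 2)

theorem memlp_two_of_summable {x : ℤ → ℂ} (h : Summable fun n => ‖x n‖ ^ 2) :
    Memℓp x (2 : ENNReal) := by
  apply memℓp_gen
  simpa using h

/-- A square summable sequence as an element of `SeqL2`. -/
noncomputable def SeqL2.mk (x : ℤ → ℂ) (h : Summable fun n => ‖x n‖ ^ 2) : SeqL2 :=
  ⟨x, memlp_two_of_summable h⟩

@[simp] theorem SeqL2.mk_apply (x : ℤ → ℂ) (h : Summable fun n => ‖x n‖ ^ 2) (n : ℤ) :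
    SeqL2.mk x h n = x n := rfl

theorem SeqL2.ext {x y : SeqL2} (h : ∀ n, x n = y n) : x = y := lp.ext (funext h)

theorem SeqL2.hasSum_sq (x : SeqL2) : HasSum (fun n => ‖x n‖ ^ 2) (‖x‖ ^ 2) := by
  have := lp.hasSum_norm (p := 2) (by simp) x
  simpa using this

theorem SeqL2.summable_sq (x : SeqL2) : Summable fun n => ‖x n‖ ^ 2 := x.hasSum_sq.summable

theorem SeqL2.norm_sq (x : SeqL2) : ‖x‖ ^ 2 = ∑' n, ‖x n‖ ^ 2 := x.hasSum_sq.tsum_eq.symm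

theorem SeqL2.norm_apply_le (x : SeqL2) (n : ℤ) : ‖x n‖ ≤ ‖x‖ :=
  lp.norm_apply_le_norm (by simp) x n

/-- Dominated convergence for the series of squared differences; it is what gives continuity both of
the free flow and of the breather curve. -/
theorem SeqL2.tendsto_of_dominated {ι : Type*} {l : Filter ι} {x : ι → SeqL2} {y : SeqL2}
    {b : ℤ → ℝ} (hb : Summable fun n => b n ^ 2)
    (hx : ∀ n, Tendsto (fun i => x i n) l (𝓝 (y n)))
    (hbd : ∀ᶠ i in l, ∀ n, ‖x i n - y n‖ ≤ b n) : Tendsto x l (𝓝 y) := by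
  rw [tendsto_iff_norm_sub_tendsto_zero]
  have h : Tendsto (fun i => ∑' n, ‖x i n - y n‖ ^ 2) l (𝓝 (∑' _ : ℤ, (0 : ℝ))) := by
    refine tendsto_tsum_of_dominated_convergence hb (fun n => ?_) ?_
    · have := ((hx n).sub_const (y n)).norm.pow 2
      simpa using this
    · filter_upwards [hbd] with i hi n
      rw [Real.norm_of_nonneg (by positivity)]
      exact pow_le_pow_left₀ (norm_nonneg _) (hi n) 2
  have h2 : Tendsto (fun i => ‖x i - y‖ ^ 2) l (𝓝 0) := by
    simpa [SeqL2.norm_sq] using h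
  have := h2.sqrt
  simpa [Real.sqrt_sq] using this

/-- Evaluation of a sequence at an index, as a continuous linear map. -/
noncomputable def SeqL2.coord (n : ℤ) : SeqL2 →L[ℝ] ℂ :=
  LinearMap.mkContinuous
    { toFun := fun x => x n, map_add' := fun _ _ => rfl, map_smul' := fun _ _ => rfl } 1
    (fun x => by rw [one_mul]; exact x.norm_apply_le n)

@[simp] theorem SeqL2.coord_apply (n : ℤ) (x : SeqL2) : SeqL2.coord n x = x n := rfl

/-- A curve in `ℓ²` all of whose coordinates are differentiable, with derivatives the coordinates
of a continuous curve, is differentiable. -/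
theorem SeqL2.hasDerivWithinAt_of_coord {p q : ℝ} {v g : ℝ → SeqL2}
    (hg : ContinuousOn g (Icc p q))
    (h : ∀ n, ∀ t ∈ Icc p q, HasDerivWithinAt (fun τ => v τ n) (g t n) (Icc p q) t) :
    ∀ t ∈ Icc p q, HasDerivWithinAt v (g t) (Icc p q) t := by
  intro t ht
  have hpq : p ≤ q := ht.1.trans ht.2
  -- The candidate is the primitive of `g`. Extending `g` by constants beyond the endpoints makes
  -- the integrand continuous on the line, so `G` has a two-sided derivative on the whole closed
  -- interval.
  set G : ℝ → SeqL2 := fun τ => v p + ∫ r in p..τ, IccExtend hpq (fun z => g z) r with hG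
  have hc : Continuous (IccExtend hpq (fun z : Icc p q => g z)) :=
    (continuousOn_iff_continuous_domRestrict.1 hg).Icc_extend'
  have hGd : ∀ τ ∈ Icc p q, HasDerivAt G (g τ) τ := by
    intro τ hτ
    have := (intervalIntegral.integral_hasDerivAt_right (hc.intervalIntegrable p τ)
      (hc.stronglyMeasurableAtFilter _ _) hc.continuousAt).const_add (v p)
    rwa [IccExtend_of_mem hpq _ hτ] at this
  have heq : ∀ τ ∈ Icc p q, v τ = G τ := by
    intro τ hτ
    apply SeqL2.ext
    intro n
    have hd : ∀ r ∈ Icc p q, HasDerivWithinAt (fun r => v r n - G r n) 0 (Icc p q) r := by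
      intro r hr
      have h1 := ((SeqL2.coord n).hasFDerivAt.comp_hasDerivAt r (hGd r hr)).hasDerivWithinAt
        (s := Icc p q)
      have h2 := (h n r hr).sub h1
      rw [SeqL2.coord_apply, sub_self] at h2
      exact h2
    have := constant_of_has_deriv_right_zero
      (fun r hr => (hd r hr).continuousWithinAt)
      (fun r hr => (hd r ⟨hr.1, hr.2.le⟩).mono_of_mem_nhdsWithin
        (Icc_mem_nhdsGE_of_mem hr)) τ hτ
    have hp : v p n - G p n = 0 := by simp [hG]
    rw [hp] at this
    exact sub_eq_zero.1 this
  exact (hGd t ht).hasDerivWithinAt.congr heq (heq t ht)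

/-- Multiplication of the `n`-th coordinate by `e^{iθ_n}`. -/
noncomputable def rot (θ : ℤ → ℝ) (x : SeqL2) : SeqL2 :=
  SeqL2.mk (fun n => Complex.exp (θ n * Complex.I) * x n)
    (by simpa [Complex.norm_exp_ofReal_mul_I] using x.summable_sq)

@[simp] theorem rot_apply (θ : ℤ → ℝ) (x : SeqL2) (n : ℤ) :
    rot θ x n = Complex.exp (θ n * Complex.I) * x n := rfl

@[simp] theorem norm_rot (θ : ℤ → ℝ) (x : SeqL2) : ‖rot θ x‖ = ‖x‖ := by
  have : ‖rot θ x‖ ^ 2 = ‖x‖ ^ 2 := by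
    simp [SeqL2.norm_sq, Complex.norm_exp_ofReal_mul_I]
  exact (pow_left_inj₀ (norm_nonneg _) (norm_nonneg _) two_ne_zero).1 this

theorem rot_sub (θ : ℤ → ℝ) (x y : SeqL2) : rot θ (x - y) = rot θ x - rot θ y := by
  apply SeqL2.ext; intro n; simp [mul_sub]

theorem rot_rot_neg (θ : ℤ → ℝ) (x : SeqL2) : rot θ (rot (-θ) x) = x := by
  apply SeqL2.ext; intro n
  simp [← mul_assoc, ← Complex.exp_add]

theorem rot_neg_rot (θ : ℤ → ℝ) (x : SeqL2) : rot (-θ) (rot θ x) = x := by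
  simpa using rot_rot_neg (-θ) x

/-- The phases need not converge uniformly in n, so rotations converge only strongly: dominated
convergence treats the fixed vector `y`, and the isometry property absorbs `x i - y`. -/
theorem tendsto_rot {ι : Type*} {l : Filter ι} {θ : ι → ℤ → ℝ} {θ' : ℤ → ℝ}
    {x : ι → SeqL2} {y : SeqL2} (hθ : ∀ n, Tendsto (fun i => θ i n) l (𝓝 (θ' n)))
    (hx : Tendsto x l (𝓝 y)) : Tendsto (fun i => rot (θ i) (x i)) l (𝓝 (rot θ' y)) := by
  have h1 : Tendsto (fun i => rot (θ i) y) l (𝓝 (rot θ' y)) := by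
    refine SeqL2.tendsto_of_dominated (b := fun n => 2 * ‖y n‖) ?_ (fun n => ?_) ?_
    · simpa [mul_pow] using y.summable_sq.mul_left (2 ^ 2)
    · simp only [rot_apply]
      have hc : Continuous fun r : ℝ => Complex.exp (r * Complex.I) * y n := by fun_prop
      exact (hc.tendsto _).comp (hθ n)
    · refine Eventually.of_forall fun i n => (norm_sub_le _ _).trans ?_
      simp [Complex.norm_exp_ofReal_mul_I, two_mul]
  have h2 : Tendsto (fun i => rot (θ i) (x i - y)) l (𝓝 0) := by
    rw [tendsto_zero_iff_norm_tendsto_zero]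
    simpa using tendsto_iff_norm_sub_tendsto_zero.1 hx
  have := h2.add h1
  simpa [rot_sub] using this

/-- Complex conjugation of functions, on the side of Fourier coefficients. -/
noncomputable def conjSeq (x : SeqL2) : SeqL2 :=
  SeqL2.mk (fun n => starRingEnd ℂ (x (-n)))
    (by simpa [Function.comp_def] using (Equiv.neg ℤ).summable_iff.2 x.summable_sq)

@[simp] theorem conjSeq_apply (x : SeqL2) (n : ℤ) : conjSeq x n = starRingEnd ℂ (x (-n)) := rfl

@[simp] theorem norm_conjSeq (x : SeqL2) : ‖conjSeq x‖ = ‖x‖ := by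
  have : ‖conjSeq x‖ ^ 2 = ‖x‖ ^ 2 := by
    simp only [SeqL2.norm_sq, conjSeq_apply, RCLike.norm_conj]
    exact (Equiv.neg ℤ).tsum_eq (fun n => ‖x n‖ ^ 2)
  exact (pow_left_inj₀ (norm_nonneg _) (norm_nonneg _) two_ne_zero).1 this

theorem conjSeq_sub (x y : SeqL2) : conjSeq (x - y) = conjSeq x - conjSeq y := by
  apply SeqL2.ext; intro n; simp

/-! ### Weighted convolution algebra and the cubic nonlinearity -/

/-- Weights for which weighted `ℓ²` is an algebra under convolution. -/
structure AlgWeight (m : ℤ → ℝ) : Prop where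
  pos : ∀ n, 0 < m n
  neg : ∀ n, m (-n) = m n
  summable : Summable fun n => (m n)⁻¹ ^ 2
  subadd : ∃ K : ℝ, 0 < K ∧ ∀ j n, m (j + n) ≤ K * (m j + m n)

namespace AlgWeight
variable {m : ℤ → ℝ}

theorem summable_div (hm : AlgWeight m) (x : SeqL2) : Summable fun n => ‖x n / m n‖ := by
  refine Summable.of_nonneg_of_le (fun _ => norm_nonneg _) (fun n => ?_)
    (x.summable_sq.add hm.summable)
  rw [norm_div, Complex.norm_real, Real.norm_of_nonneg (hm.pos n).le, div_eq_mul_inv]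
  nlinarith [sq_nonneg (‖x n‖ - (m n)⁻¹), sq_nonneg (‖x n‖ + (m n)⁻¹)]

theorem summable_conv (hm : AlgWeight m) (x y : SeqL2) (n : ℤ) :
    Summable fun j => ‖x j / m j * (y (n - j) / m (n - j))‖ := by
  have hy : ∀ j, ‖y j / m j‖ ≤ ∑' j, ‖y j / m j‖ := fun j =>
    (hm.summable_div y).le_tsum j fun _ _ => norm_nonneg _
  refine Summable.of_nonneg_of_le (fun _ => norm_nonneg _) (fun j => ?_)
    ((hm.summable_div x).mul_right (∑' j, ‖y j / m j‖))
  rw [norm_mul]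
  exact mul_le_mul_of_nonneg_left (hy _) (norm_nonneg _)

/-- Weighted convolution. -/
noncomputable def conv (m : ℤ → ℝ) (x y : SeqL2) (n : ℤ) : ℂ :=
  m n * ∑' j, x j / m j * (y (n - j) / m (n - j))

theorem summable_sq_prod (x y : SeqL2) :
    HasSum (fun z : ℤ × ℤ => ‖x z.2‖ ^ 2 * ‖y (z.1 - z.2)‖ ^ 2) (‖x‖ ^ 2 * ‖y‖ ^ 2) := by
  have h : HasSum (fun z : ℤ × ℤ => ‖x z.1‖ ^ 2 * ‖y z.2‖ ^ 2) (‖x‖ ^ 2 * ‖y‖ ^ 2) := by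
    apply x.hasSum_sq.mul y.hasSum_sq
    exact x.summable_sq.mul_of_nonneg y.summable_sq (fun _ => by positivity) (fun _ => by positivity)
  let e : ℤ × ℤ ≃ ℤ × ℤ :=
    { toFun := fun z => (z.2, z.1 - z.2)
      invFun := fun z => (z.1 + z.2, z.1)
      left_inv := fun z => by simp
      right_inv := fun z => by simp }
  exact (e.hasSum_iff (f := fun z : ℤ × ℤ => ‖x z.1‖ ^ 2 * ‖y z.2‖ ^ 2)).2 h

theorem summable_inv_shift (hm : AlgWeight m) (n : ℤ) : Summable fun j => (m (n - j))⁻¹ ^ 2 :=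
  (Equiv.subLeft n).summable_iff.2 hm.summable

/-- Dividing m n ≤ K (m j + m (n - j)) by m j · m (n - j) bounds the kernel by K ((m j)⁻¹ + (m (n -
j))⁻¹), which is square summable in j uniformly in n. Cauchy–Schwarz in j finishes. -/
theorem exists_conv_sq_le (hm : AlgWeight m) : ∃ C : ℝ, 0 < C ∧ ∀ (x y : SeqL2) (n : ℤ),
    ‖conv m x y n‖ ^ 2 ≤ C * ∑' j, ‖x j‖ ^ 2 * ‖y (n - j)‖ ^ 2 := by
  obtain ⟨K, hK, hsub⟩ := hm.subadd
  set S := ∑' n, (m n)⁻¹ ^ 2 with hS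
  have hSpos : 0 < S := hm.summable.tsum_pos (fun _ => by positivity) 0
    (by have := hm.pos 0; positivity)
  -- One factor 2 comes from (p + q)² ≤ 2(p² + q²), the other from the two inverse weights, each of
  -- whose squares sum to `S`.
  refine ⟨4 * K ^ 2 * S, by positivity, fun x y n => ?_⟩
  have hS' : ∑' j, (m (n - j))⁻¹ ^ 2 = S := (Equiv.subLeft n).tsum_eq fun j => (m j)⁻¹ ^ 2
  set a : ℤ → ℝ := fun j => K * ((m j)⁻¹ + (m (n - j))⁻¹)
  set b : ℤ → ℝ := fun j => ‖x j‖ * ‖y (n - j)‖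
  have ha2 : ∀ j, a j ^ 2 ≤ 2 * K ^ 2 * ((m j)⁻¹ ^ 2 + (m (n - j))⁻¹ ^ 2) := fun j => by
    have : 0 ≤ K ^ 2 * ((m j)⁻¹ - (m (n - j))⁻¹) ^ 2 := by positivity
    simp only [a]; nlinarith
  have hsum2 := (hm.summable.add (hm.summable_inv_shift n)).mul_left (2 * K ^ 2)
  have has : Summable fun j => a j ^ 2 :=
    Summable.of_nonneg_of_le (fun _ => by positivity) ha2 hsum2
  have hbs : Summable fun j => b j ^ 2 := by
    simpa [b, mul_pow] using (summable_sq_prod x y).summable.prod_factor n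
  have hA : ∑' j, a j ^ 2 ≤ 4 * K ^ 2 * S := by
    refine (has.tsum_le_tsum ha2 hsum2).trans (le_of_eq ?_)
    rw [tsum_mul_left, hm.summable.tsum_add (hm.summable_inv_shift n), hS', ← hS]; ring
  have ha0 : ∀ j, 0 ≤ a j := fun j => by
    have h1 := hm.pos j; have h2 := hm.pos (n - j); positivity
  have hb0 : ∀ j, 0 ≤ b j := fun j => by positivity
  obtain ⟨hab, hCS⟩ := Real.summable_and_inner_le_Lp_mul_Lq_tsum_of_nonneg
    Real.HolderConjugate.two_two ha0 hb0 (by simpa using has) (by simpa using hbs)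
  have hterm : ∀ j, m n * ‖x j / m j * (y (n - j) / m (n - j))‖ ≤ a j * b j := fun j => by
    have h1 := hm.pos j; have h2 := hm.pos (n - j)
    have h3 := hsub j (n - j)
    rw [add_sub_cancel] at h3
    rw [norm_mul, norm_div, norm_div, Complex.norm_real, Complex.norm_real,
      Real.norm_of_nonneg h1.le, Real.norm_of_nonneg h2.le]
    have e1 : m n * (‖x j‖ / m j * (‖y (n - j)‖ / m (n - j))) =
      m n * ((m j)⁻¹ * (m (n - j))⁻¹) * b j := by simp only [b]; field_simp
    have e2 : a j = K * (m j + m (n - j)) * ((m j)⁻¹ * (m (n - j))⁻¹) := by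
      simp only [a]; field_simp; ring
    rw [e1, e2]
    gcongr
  have hle : ‖conv m x y n‖ ≤ ∑' j, a j * b j := by
    rw [conv, norm_mul, Complex.norm_real, Real.norm_of_nonneg (hm.pos n).le]
    calc _ ≤ m n * ∑' j, ‖x j / m j * (y (n - j) / m (n - j))‖ := by
            gcongr
            · exact (hm.pos n).le
            exact norm_tsum_le_tsum_norm (hm.summable_conv x y n)
      _ = ∑' j, m n * ‖x j / m j * (y (n - j) / m (n - j))‖ := tsum_mul_left.symm
      _ ≤ _ := ((hm.summable_conv x y n).mul_left _).tsum_le_tsum hterm hab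
  have h2 : (∑' j, a j * b j) ^ 2 ≤ (∑' j, a j ^ 2) * ∑' j, b j ^ 2 := by
    have hA0 : 0 ≤ ∑' j, a j ^ 2 := tsum_nonneg fun _ => by positivity
    have hB0 : 0 ≤ ∑' j, b j ^ 2 := tsum_nonneg fun _ => by positivity
    have hn : 0 ≤ ∑' j, a j * b j := tsum_nonneg fun j => mul_nonneg (ha0 j) (hb0 j)
    simp only [Real.rpow_two, ← Real.sqrt_eq_rpow] at hCS
    calc _ ≤ _ := pow_le_pow_left₀ hn hCS 2
      _ = _ := by rw [mul_pow, Real.sq_sqrt hA0, Real.sq_sqrt hB0]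
  calc _ ≤ (∑' j, a j * b j) ^ 2 := pow_le_pow_left₀ (norm_nonneg _) hle 2
    _ ≤ _ := h2
    _ ≤ (4 * K ^ 2 * S) * ∑' j, b j ^ 2 := by
      gcongr
    _ = _ := by simp only [b, mul_pow]

theorem summable_conv_sq (hm : AlgWeight m) (x y : SeqL2) :
    Summable fun n => ‖conv m x y n‖ ^ 2 := by
  obtain ⟨C, _, hC⟩ := hm.exists_conv_sq_le
  exact Summable.of_nonneg_of_le (fun _ => by positivity) (hC x y)
    ((summable_sq_prod x y).summable.prod.mul_left C)

/-- Weighted convolution as a product on `ℓ²`. -/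
noncomputable def mul (hm : AlgWeight m) (x y : SeqL2) : SeqL2 :=
  SeqL2.mk (conv m x y) (hm.summable_conv_sq x y)

theorem mul_apply (hm : AlgWeight m) (x y : SeqL2) (n : ℤ) :
    hm.mul x y n = m n * ∑' j, x j / m j * (y (n - j) / m (n - j)) := rfl

/-- Summing the pointwise bound over n, the double series factors as ‖x‖²‖y‖² after the change of
indices (n, j) ↦ (j, n - j). -/
theorem exists_norm_mul_le (hm : AlgWeight m) :
    ∃ C : ℝ, 0 < C ∧ ∀ x y : SeqL2, ‖hm.mul x y‖ ≤ C * ‖x‖ * ‖y‖ := by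
  obtain ⟨C, hC0, hC⟩ := hm.exists_conv_sq_le
  refine ⟨Real.sqrt C, by positivity, fun x y => ?_⟩
  refine le_of_sq_le_sq ?_ (by positivity)
  rw [SeqL2.norm_sq, mul_pow, mul_pow, Real.sq_sqrt hC0.le]
  calc _ ≤ ∑' n, C * ∑' j, ‖x j‖ ^ 2 * ‖y (n - j)‖ ^ 2 :=
        (hm.summable_conv_sq x y).tsum_le_tsum (hC x y)
          ((summable_sq_prod x y).summable.prod.mul_left C)
    _ = C * (‖x‖ ^ 2 * ‖y‖ ^ 2) := by
      rw [tsum_mul_left, ← (summable_sq_prod x y).summable.tsum_prod,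
        (summable_sq_prod x y).tsum_eq]
    _ = _ := by ring

theorem mul_sub_left (hm : AlgWeight m) (x y z : SeqL2) :
    hm.mul (x - y) z = hm.mul x z - hm.mul y z := by
  apply SeqL2.ext; intro n
  rw [lp.coeFn_sub, Pi.sub_apply]
  simp only [mul_apply]
  rw [← _root_.mul_sub, ← (hm.summable_conv x z n).of_norm.tsum_sub
    (hm.summable_conv y z n).of_norm]
  congr 2; ext j
  rw [lp.coeFn_sub, Pi.sub_apply]; ring

theorem mul_sub_right (hm : AlgWeight m) (x y z : SeqL2) :
    hm.mul z (x - y) = hm.mul z x - hm.mul z y := by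
  apply SeqL2.ext; intro n
  rw [lp.coeFn_sub, Pi.sub_apply]
  simp only [mul_apply]
  rw [← _root_.mul_sub, ← (hm.summable_conv z x n).of_norm.tsum_sub
    (hm.summable_conv z y n).of_norm]
  congr 2; ext j
  rw [lp.coeFn_sub, Pi.sub_apply]; ring

/-- The cubic nonlinearity `|u|²u` on the side of weighted Fourier coefficients. -/
noncomputable def cubic (hm : AlgWeight m) (x : SeqL2) : SeqL2 :=
  hm.mul (hm.mul x (conjSeq x)) x

theorem exists_cubic_lipschitz (hm : AlgWeight m) : ∃ C : ℝ, 0 < C ∧ ∀ (M : ℝ) (x y : SeqL2),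
    ‖x‖ ≤ M → ‖y‖ ≤ M → ‖hm.cubic x - hm.cubic y‖ ≤ C * M ^ 2 * ‖x - y‖ := by
  obtain ⟨C, hC0, hC⟩ := hm.exists_norm_mul_le
  refine ⟨3 * C ^ 2, by positivity, fun M x y hx hy => ?_⟩
  have hM : 0 ≤ M := (norm_nonneg x).trans hx
  -- Telescoping: the three factors are replaced one at a time.
  have key : hm.cubic x - hm.cubic y =
      hm.mul (hm.mul (x - y) (conjSeq x)) x + hm.mul (hm.mul y (conjSeq (x - y))) x
        + hm.mul (hm.mul y (conjSeq y)) (x - y) := by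
    simp only [cubic, conjSeq_sub, mul_sub_left, mul_sub_right]; abel
  have h3 : ∀ u v w : SeqL2, ‖hm.mul (hm.mul u v) w‖ ≤ C ^ 2 * (‖u‖ * ‖v‖ * ‖w‖) := by
    intro u v w
    calc _ ≤ C * ‖hm.mul u v‖ * ‖w‖ := hC _ _
      _ ≤ C * (C * ‖u‖ * ‖v‖) * ‖w‖ := by gcongr; exact hC _ _
      _ = _ := by ring
  rw [key]
  calc _ ≤ C ^ 2 * (‖x - y‖ * ‖conjSeq x‖ * ‖x‖) + C ^ 2 * (‖y‖ * ‖conjSeq (x - y)‖ * ‖x‖)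
        + C ^ 2 * (‖y‖ * ‖conjSeq y‖ * ‖x - y‖) :=
        norm_add₃_le.trans (add_le_add (add_le_add (h3 _ _ _) (h3 _ _ _)) (h3 _ _ _))
    _ ≤ C ^ 2 * (‖x - y‖ * M * M) + C ^ 2 * (M * ‖x - y‖ * M) + C ^ 2 * (M * M * ‖x - y‖) := by
        simp only [norm_conjSeq]; gcongr
    _ = _ := by ring

@[simp] theorem cubic_zero (hm : AlgWeight m) : hm.cubic 0 = 0 := by
  apply SeqL2.ext; intro n; simp [cubic, mul_apply]

theorem continuous_cubic (hm : AlgWeight m) : Continuous hm.cubic := by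
  obtain ⟨C, hC0, hC⟩ := hm.exists_cubic_lipschitz
  rw [continuous_iff_continuousAt]
  intro x
  rw [ContinuousAt, tendsto_iff_norm_sub_tendsto_zero]
  have h : Tendsto (fun y => C * (‖x‖ + 1) ^ 2 * ‖y - x‖) (𝓝 x) (𝓝 0) := by
    have : Continuous fun y => C * (‖x‖ + 1) ^ 2 * ‖y - x‖ := by fun_prop
    simpa using this.tendsto x
  refine squeeze_zero' (Eventually.of_forall fun _ => norm_nonneg _) ?_ h
  filter_upwards [Metric.ball_mem_nhds x one_pos] with y hy
  refine hC _ y x ?_ (by linarith)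
  rw [mem_ball_iff_norm] at hy
  linarith [norm_le_norm_add_norm_sub' y x]

end AlgWeight
end NLS

/-! ### Fourier characters, synthesis and periodic Sobolev spaces -/

namespace NLS

/-- The `n`-th frequency of `L`-periodic functions. -/
noncomputable def freq (L : ℝ) (n : ℤ) : ℝ := 2 * Real.pi * n / L

/-- The `n`-th character of period `L`. -/
noncomputable def eChar (L : ℝ) (n : ℤ) (x : ℝ) : ℂ :=
  Complex.exp (Complex.I * ((freq L n * x : ℝ) : ℂ))

theorem freq_add (L : ℝ) (j n : ℤ) : freq L (j + n) = freq L j + freq L n := by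
  simp only [freq]; push_cast; ring

@[simp] theorem freq_neg (L : ℝ) (n : ℤ) : freq L (-n) = -freq L n := by
  simp only [freq]; push_cast; ring

theorem eChar_add (L : ℝ) (j n : ℤ) (x : ℝ) : eChar L (j + n) x = eChar L j x * eChar L n x := by
  simp only [eChar, freq_add, ← Complex.exp_add]
  push_cast; ring_nf

@[simp] theorem eChar_zero (L x : ℝ) : eChar L 0 x = 1 := by simp [eChar, freq]

theorem eChar_neg (L : ℝ) (n : ℤ) (x : ℝ) : eChar L (-n) x = starRingEnd ℂ (eChar L n x) := by
  simp only [eChar, ← Complex.exp_conj, map_mul, Complex.conj_I, Complex.conj_ofReal, freq_neg]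
  push_cast; ring_nf

@[simp] theorem norm_eChar (L : ℝ) (n : ℤ) (x : ℝ) : ‖eChar L n x‖ = 1 := by
  rw [eChar, mul_comm, Complex.norm_exp_ofReal_mul_I]

theorem contDiff_eChar (L : ℝ) (n : ℤ) : ContDiff ℝ ∞ (eChar L n) := by
  have h : ContDiff ℝ ∞ fun x : ℝ => ((freq L n * x : ℝ) : ℂ) :=
    Complex.ofRealCLM.contDiff.comp (contDiff_const.mul contDiff_id)
  exact (contDiff_const.mul h).cexp

@[fun_prop] theorem continuous_eChar (L : ℝ) (n : ℤ) : Continuous (eChar L n) :=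
  (contDiff_eChar L n).continuous

theorem hasDerivAt_eChar (L : ℝ) (n : ℤ) (x : ℝ) :
    HasDerivAt (eChar L n) (Complex.I * freq L n * eChar L n x) x := by
  have h : HasDerivAt (fun x : ℝ => Complex.I * ((freq L n * x : ℝ) : ℂ))
      (Complex.I * freq L n) x := by
    have := (((hasDerivAt_id x).const_mul (freq L n)).ofReal_comp).const_mul Complex.I
    simpa using this
  have := h.cexp
  rwa [mul_comm] at this

theorem deriv_eChar (L : ℝ) (n : ℤ) :
    deriv (eChar L n) = fun x => Complex.I * freq L n * eChar L n x :=
  funext fun x => (hasDerivAt_eChar L n x).deriv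

theorem deriv_deriv_eChar (L : ℝ) (n : ℤ) :
    deriv (deriv (eChar L n)) = fun x => -(freq L n : ℂ) ^ 2 * eChar L n x := by
  funext x
  rw [deriv_eChar]
  have := ((hasDerivAt_eChar L n x).const_mul (Complex.I * (freq L n : ℂ))).deriv
  rw [this]
  linear_combination (freq L n : ℂ) ^ 2 * eChar L n x * Complex.I_sq

theorem eChar_periodic {L : ℝ} (hL : L ≠ 0) (n : ℤ) : Function.Periodic (eChar L n) L := by
  intro x
  have h : freq L n * L = n * (2 * Real.pi) := by simp only [freq]; field_simp
  simp only [eChar, mul_add, h]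
  rw [Complex.ofReal_add, mul_add, Complex.exp_add]
  have : Complex.I * ((n * (2 * Real.pi) : ℝ) : ℂ) = n * (2 * Real.pi * Complex.I) := by
    push_cast; ring
  rw [this, Complex.exp_int_mul_two_pi_mul_I, mul_one]

theorem freq_ne_zero {L : ℝ} (hL : L ≠ 0) {n : ℤ} (hn : n ≠ 0) : freq L n ≠ 0 := by
  simp only [freq]
  have : (n : ℝ) ≠ 0 := by exact_mod_cast hn
  have := Real.pi_ne_zero
  positivity

theorem integral_eChar {L : ℝ} (hL : L ≠ 0) (n : ℤ) :
    ∫ x in (0 : ℝ)..L, eChar L n x = if n = 0 then (L : ℂ) else 0 := by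
  split_ifs with hn
  · subst hn; simp
  · have hc : Complex.I * (freq L n : ℂ) ≠ 0 :=
      mul_ne_zero Complex.I_ne_zero (by exact_mod_cast freq_ne_zero hL hn)
    have hd : ∀ x ∈ uIcc 0 L, HasDerivAt (fun x => (Complex.I * (freq L n : ℂ))⁻¹ * eChar L n x)
        (eChar L n x) x := fun x _ => by
      have := (hasDerivAt_eChar L n x).const_mul (Complex.I * (freq L n : ℂ))⁻¹
      rwa [inv_mul_cancel_left₀ hc] at this
    rw [intervalIntegral.integral_eq_sub_of_hasDerivAt hd
      ((continuous_eChar L n).intervalIntegrable _ _)]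
    have := eChar_periodic hL n 0
    rw [zero_add] at this
    simp [this]

theorem fourierCoef_eq (L : ℝ) (f : ℝ → ℂ) (n : ℤ) :
    fourierCoef L f n = (1 / (L : ℂ)) * ∫ x in (0 : ℝ)..L, eChar L (-n) x * f x := by
  simp only [fourierCoef, eChar, freq]
  congr 2; ext x; congr 2; push_cast; ring

theorem integral_eChar_mul {L : ℝ} (hL : L ≠ 0) (f : ℝ → ℂ) (n : ℤ) :
    ∫ x in (0 : ℝ)..L, eChar L (-n) x * f x = L * fourierCoef L f n := by
  rw [fourierCoef_eq]
  have : (L : ℂ) ≠ 0 := by exact_mod_cast hL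
  field_simp

/-- The function with Fourier coefficients `x n / m n`. -/
noncomputable def synth (L : ℝ) (m : ℤ → ℝ) (x : SeqL2) (ξ : ℝ) : ℂ :=
  ∑' n, x n / m n * eChar L n ξ

section synth
variable {L : ℝ} {m : ℤ → ℝ}

theorem summable_synth (hm : AlgWeight m) (x : SeqL2) (ξ : ℝ) :
    Summable fun n => ‖x n / m n * eChar L n ξ‖ := by
  simpa using hm.summable_div x

theorem synth_sub (hm : AlgWeight m) (x y : SeqL2) :
    synth L m (x - y) = synth L m x - synth L m y := by
  funext ξ
  simp only [synth, Pi.sub_apply]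
  rw [← (summable_synth hm x ξ).of_norm.tsum_sub (summable_synth hm y ξ).of_norm]
  congr 1; ext n
  rw [lp.coeFn_sub, Pi.sub_apply]; ring

theorem synth_conj (x : SeqL2) (hm : AlgWeight m) (ξ : ℝ) :
    synth L m (conjSeq x) ξ = starRingEnd ℂ (synth L m x ξ) := by
  simp only [synth]
  rw [Complex.conj_tsum, ← (Equiv.neg ℤ).tsum_eq]
  congr 1; ext n
  simp [hm.neg, eChar_neg]

/-- Two absolutely convergent Fourier series are multiplied and regrouped along j + (n - j) = n; the
factor m n in `AlgWeight.mul` cancels the division in `synth`. -/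
theorem synth_mul (hm : AlgWeight m) (x y : SeqL2) (ξ : ℝ) :
    synth L m (hm.mul x y) ξ = synth L m x ξ * synth L m y ξ := by
  let e : ℤ × ℤ ≃ ℤ × ℤ :=
    { toFun := fun z => (z.2, z.1 - z.2)
      invFun := fun z => (z.1 + z.2, z.1)
      left_inv := fun z => by simp
      right_inv := fun z => by simp }
  have hs := summable_mul_of_summable_norm (summable_synth (L := L) hm x ξ)
    (summable_synth (L := L) hm y ξ)
  have hs' := e.summable_iff.2 hs
  simp only [synth]
  rw [tsum_mul_tsum_of_summable_norm (summable_synth hm x ξ) (summable_synth hm y ξ),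
    ← e.tsum_eq]
  rw [Function.comp_def] at hs'
  rw [hs'.tsum_prod]
  congr 1; ext n
  have hn : (m n : ℂ) ≠ 0 := by exact_mod_cast (hm.pos n).ne'
  rw [AlgWeight.mul_apply, mul_div_cancel_left₀ _ hn, ← tsum_mul_right]
  congr 1; ext j
  have : eChar L n ξ = eChar L j ξ * eChar L (n - j) ξ := by rw [← eChar_add, add_sub_cancel]
  simp only [e, Equiv.coe_fn_mk, this]
  ring

theorem synth_cubic (hm : AlgWeight m) (x : SeqL2) (ξ : ℝ) :
    synth L m (hm.cubic x) ξ = (‖synth L m x ξ‖ ^ 2 : ℝ) * synth L m x ξ := by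
  rw [AlgWeight.cubic, synth_mul, synth_mul, synth_conj _ hm, Complex.mul_conj,
    Complex.normSq_eq_norm_sq]

theorem continuous_synth (hm : AlgWeight m) (x : SeqL2) : Continuous (synth L m x) :=
  continuous_tsum (fun n => by fun_prop) (hm.summable_div x) (fun n ξ => by simp)

theorem synth_periodic (hL : L ≠ 0) (x : SeqL2) : Function.Periodic (synth L m x) L := by
  intro ξ
  simp only [synth, eChar_periodic hL _ ξ]

/-- Termwise integration, licensed by the absolutely summable coefficients x n / m n and the
boundedness of characters. -/
theorem hasSum_integral_synth_mul (hm : AlgWeight m) (x : SeqL2) {ψ : ℝ → ℂ}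
    (hψ : Continuous ψ) :
    HasSum (fun n => x n / m n * ∫ ξ in (0 : ℝ)..L, eChar L n ξ * ψ ξ)
      (∫ ξ in (0 : ℝ)..L, synth L m x ξ * ψ ξ) := by
  have h : ∀ n, x n / m n * ∫ ξ in (0 : ℝ)..L, eChar L n ξ * ψ ξ =
      ∫ ξ in (0 : ℝ)..L, x n / m n * eChar L n ξ * ψ ξ := fun n => by
    rw [← intervalIntegral.integral_const_mul]
    simp only [mul_assoc]
  simp only [h]
  refine intervalIntegral.hasSum_integral_of_dominated_convergence
    (fun n ξ => ‖x n / m n‖ * ‖ψ ξ‖) (fun n => ?_) (fun n => ?_) ?_ ?_ ?_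
  · exact Continuous.aestronglyMeasurable (by fun_prop)
  · exact Eventually.of_forall fun ξ _ => by simp
  · exact Eventually.of_forall fun ξ _ => (hm.summable_div x).mul_right _
  · simp only [tsum_mul_right]
    exact Continuous.intervalIntegrable (by fun_prop) _ _
  · exact Eventually.of_forall fun ξ _ => (summable_synth hm x ξ).of_norm.hasSum.mul_right _

theorem fourierCoef_synth (hL : L ≠ 0) (hm : AlgWeight m) (x : SeqL2) (n : ℤ) :
    fourierCoef L (synth L m x) n = x n / m n := by
  have h1 := (hasSum_integral_synth_mul (L := L) hm x (continuous_eChar L (-n))).tsum_eq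
  have h2 : ∀ j : ℤ, x j / m j * ∫ ξ in (0 : ℝ)..L, eChar L j ξ * eChar L (-n) ξ =
      if j = n then x n / m n * L else 0 := fun j => by
    simp only [← eChar_add, integral_eChar hL]
    by_cases hj : j = n
    · simp [hj]
    · have : j + -n ≠ 0 := by omega
      simp [this, hj]
  simp only [h2, tsum_ite_eq] at h1
  rw [fourierCoef_eq]
  simp only [mul_comm (eChar L (-n) _)]
  rw [← h1]
  have : (L : ℂ) ≠ 0 := by exact_mod_cast hL
  field_simp

end synth

theorem fourierCoef_congr {L : ℝ} {f g : ℝ → ℂ} (h : f =ᵐ[volume] g) (n : ℤ) :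
    fourierCoef L f n = fourierCoef L g n := by
  simp only [fourierCoef]
  congr 1
  apply intervalIntegral.integral_congr_ae
  filter_upwards [h] with x hx _
  rw [hx]

theorem intervalIntegrable_of_memLp {L : ℝ} (hL : 0 < L) {f : ℝ → ℂ}
    (hf : MemLp f 2 (volume.restrict (Ioc 0 L))) : IntervalIntegrable f volume 0 L := by
  rw [intervalIntegrable_iff_integrableOn_Ioc_of_le hL.le]
  exact hf.integrable (by norm_num)

theorem fourierCoef_sub {L : ℝ} (hL : 0 < L) {f g : ℝ → ℂ}
    (hf : MemLp f 2 (volume.restrict (Ioc 0 L))) (hg : MemLp g 2 (volume.restrict (Ioc 0 L)))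
    (n : ℤ) : fourierCoef L (f - g) n = fourierCoef L f n - fourierCoef L g n := by
  rw [fourierCoef_eq, fourierCoef_eq, fourierCoef_eq, ← mul_sub,
    ← intervalIntegral.integral_sub]
  · congr 2; ext x; simp [mul_sub]
  · exact (intervalIntegrable_of_memLp hL hf).continuousOn_mul (continuous_eChar L _).continuousOn
  · exact (intervalIntegrable_of_memLp hL hg).continuousOn_mul (continuous_eChar L _).continuousOn

theorem fourierCoeffOn_eq_fourierCoef {L : ℝ} (hL : 0 < L) (f : ℝ → ℂ) (n : ℤ) :
    fourierCoeffOn hL f n = fourierCoef L f n := by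
  rw [fourierCoeffOn_eq_integral, fourierCoef_eq, Complex.real_smul]
  congr 1
  · push_cast; simp
  · congr 1; ext x
    rw [fourier_coe_apply, smul_eq_mul, eChar, freq]
    congr 2; push_cast; simp; ring

/-- Functions of period `L`, square integrable over a period, are determined almost everywhere
by their Fourier coefficients. -/
theorem ae_eq_of_fourierCoef_eq {L : ℝ} (hL : 0 < L) {f g : ℝ → ℂ}
    (hfp : Function.Periodic f L) (hgp : Function.Periodic g L)
    (hf : MemLp f 2 (volume.restrict (Ioc 0 L))) (hg : MemLp g 2 (volume.restrict (Ioc 0 L)))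
    (h : ∀ n, fourierCoef L f n = fourierCoef L g n) : f =ᵐ[volume] g := by
  have hd := hf.sub hg
  -- Parseval for the difference: all its coefficients vanish, hence so does its L² norm over one
  -- period.
  have h1 := hasSum_sq_fourierCoeffOn hL hd
  simp only [fourierCoeffOn_eq_fourierCoef, fourierCoef_sub hL hf hg, h, sub_self, norm_zero,
    ne_eq, OfNat.ofNat_ne_zero, not_false_eq_true, zero_pow, sub_zero] at h1
  have h2 := h1.unique hasSum_zero
  have h3 : ∫ x in Ioc 0 L, ‖(f - g) x‖ ^ 2 = 0 := by
    rw [← intervalIntegral.integral_of_le hL.le]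
    have : L⁻¹ ≠ 0 := by positivity
    simpa [hL.ne'] using h2
  have hint : Integrable (fun x => ‖(f - g) x‖ ^ 2) (volume.restrict (Ioc 0 L)) := by
    have := hd.integrable_norm_rpow (by norm_num) (by norm_num)
    simpa using this
  have h4 := (integral_eq_zero_iff_of_nonneg (fun x => by positivity) hint).1 h3
  have h5 : volume ({x | ¬ f x = g x} ∩ Ioc 0 L) = 0 := by
    rw [← Measure.restrict_apply' measurableSet_Ioc]
    refine measure_mono_null (fun x hx => ?_) h4
    simpa [sub_eq_zero] using hx
  -- The set where f and g differ is invariant under translation by L, so being null in one period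
  -- makes it null on the line.
  have hfd := isAddFundamentalDomain_Ioc hL 0 volume
  rw [zero_add] at hfd
  refine hfd.measure_zero_of_invariant _ (fun γ => ?_) h5
  obtain ⟨γ, k, rfl⟩ := γ
  ext x
  rw [mem_vadd_set_iff_neg_vadd_mem]
  have e : (-(⟨(fun k : ℤ => k • L) k, k, rfl⟩ : AddSubgroup.zmultiples L)) +ᵥ x = x - k * L := by
    rw [AddSubgroup.vadd_def]; simp; ring
  have ef := hfp.sub_int_mul_eq (x := x) k
  have eg := hgp.sub_int_mul_eq (x := x) k
  rw [e]
  change ¬ f _ = g _ ↔ ¬ f _ = g _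
  rw [ef, eg]

/-- The square root of the weight of the Sobolev space `H^s`. -/
noncomputable def sobWeight (L s : ℝ) (n : ℤ) : ℝ := (1 + freq L n ^ 2) ^ (s / 2)

theorem sobWeight_sq (L s : ℝ) (n : ℤ) : sobWeight L s n ^ 2 = (1 + freq L n ^ 2) ^ s := by
  rw [sobWeight, ← Real.rpow_two, ← Real.rpow_mul (by positivity)]
  congr 1; ring

/-- Inverse squared weights are comparable to |n|^(-2s), summable exactly because s > 1/2. The
weight of a sum of frequencies is controlled by the weight of the larger one. -/
theorem algWeight_sobWeight {L s : ℝ} (hL : 0 < L) (hs : 1 / 2 < s) :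
    AlgWeight (sobWeight L s) where
  pos n := Real.rpow_pos_of_pos (by positivity) _
  neg n := by simp [sobWeight]
  summable := by
    have h := (Real.summable_abs_int_rpow (b := 2 * s) (by linarith)).mul_left
      ((2 * Real.pi / L) ^ (-(2 * s)))
    refine Summable.of_norm_bounded_eventually h ?_
    have hfin : {n : ℤ | n ≠ 0} ∈ cofinite := by
      rw [mem_cofinite]
      exact (finite_singleton 0).subset fun n hn => by simpa using hn
    filter_upwards [hfin] with n hn
    have hn' : 0 < |(n : ℝ)| := by simpa using hn
    have hpos : 0 < 2 * Real.pi / L := by positivity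
    rw [inv_pow, sobWeight_sq, Real.norm_of_nonneg (by positivity),
      ← Real.mul_rpow hpos.le hn'.le, Real.rpow_neg (by positivity), Real.rpow_mul (by positivity)]
    apply inv_anti₀ (by positivity)
    apply Real.rpow_le_rpow (by positivity) _ (by linarith)
    rw [Real.rpow_two, mul_pow, sq_abs, ← mul_pow]
    have : 2 * Real.pi / L * n = freq L n := by simp only [freq]; ring
    rw [this]; linarith
  subadd := by
    -- If a² ≤ b² then 1 + (a + b)² ≤ 4(1 + b²); raising to the power s/2 gives this constant.
    refine ⟨4 ^ (s / 2), by positivity, fun j n => ?_⟩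
    have key : ∀ a b : ℝ, a ^ 2 ≤ b ^ 2 → (1 + (a + b) ^ 2) ^ (s / 2) ≤
        4 ^ (s / 2) * (1 + b ^ 2) ^ (s / 2) := fun a b hab => by
      rw [← Real.mul_rpow (by norm_num) (by positivity)]
      apply Real.rpow_le_rpow (by positivity) _ (by linarith)
      nlinarith [sq_nonneg (a - b)]
    simp only [sobWeight, freq_add]
    have ha : 0 < (1 + freq L j ^ 2) ^ (s / 2) := Real.rpow_pos_of_pos (by positivity) _
    have hb : 0 < (1 + freq L n ^ 2) ^ (s / 2) := Real.rpow_pos_of_pos (by positivity) _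
    have h4 : (0 : ℝ) < 4 ^ (s / 2) := by positivity
    rcases le_total (freq L j ^ 2) (freq L n ^ 2) with h | h
    · refine (key _ _ h).trans ?_
      gcongr; linarith
    · rw [add_comm (freq L j)]
      refine (key _ _ h).trans ?_
      gcongr; linarith

section sobolev
variable {L s : ℝ}

theorem sobolevTerm_eq (L s : ℝ) (f : ℝ → ℂ) (n : ℤ) :
    sobolevTerm L s f n = ‖(sobWeight L s n : ℂ) * fourierCoef L f n‖ ^ 2 := by
  rw [norm_mul, mul_pow, Complex.norm_real, Real.norm_eq_abs, sq_abs, sobWeight_sq]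
  rfl

theorem sobolevTerm_of_ae_eq_synth (hL : 0 < L) (hs : 1 / 2 < s) {f : ℝ → ℂ} {x : SeqL2}
    (h : f =ᵐ[volume] synth L (sobWeight L s) x) (n : ℤ) : sobolevTerm L s f n = ‖x n‖ ^ 2 := by
  have hm := algWeight_sobWeight hL hs
  rw [sobolevTerm_eq, fourierCoef_congr h, fourierCoef_synth hL.ne' hm,
    mul_div_cancel₀ _ (by exact_mod_cast (hm.pos n).ne')]

theorem hsNorm_of_ae_eq_synth (hL : 0 < L) (hs : 1 / 2 < s) {f : ℝ → ℂ} {x : SeqL2}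
    (h : f =ᵐ[volume] synth L (sobWeight L s) x) : hsNorm L s f = ‖x‖ := by
  simp only [hsNorm, sobolevTerm_of_ae_eq_synth hL hs h]
  rw [← SeqL2.norm_sq, Real.sqrt_sq (norm_nonneg _)]

theorem memLp_of_continuous {f : ℝ → ℂ} (hf : Continuous f) :
    MemLp f 2 (volume.restrict (Ioc 0 L)) := by
  obtain ⟨C, hC⟩ := isCompact_Icc.exists_bound_of_continuousOn (s := Icc 0 L) hf.continuousOn
  refine MemLp.of_bound hf.aestronglyMeasurable C ?_
  filter_upwards [ae_restrict_mem measurableSet_Ioc] with x hx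
  exact hC x (Ioc_subset_Icc_self hx)

theorem memHs_synth (hL : 0 < L) (hs : 1 / 2 < s) (x : SeqL2) :
    MemHs L s (synth L (sobWeight L s) x) where
  periodic := synth_periodic hL.ne' x
  memLp := memLp_of_continuous (continuous_synth (algWeight_sobWeight hL hs) x)
  summable := by
    simp only [funext (sobolevTerm_of_ae_eq_synth hL hs (ae_eq_refl _))]
    exact x.summable_sq

theorem MemHs.exists_ae_eq_synth (hL : 0 < L) (hs : 1 / 2 < s) {f : ℝ → ℂ} (hf : MemHs L s f) :
    ∃ x : SeqL2, f =ᵐ[volume] synth L (sobWeight L s) x := by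
  have hm := algWeight_sobWeight hL hs
  have h := hf.summable
  simp only [funext (sobolevTerm_eq L s f)] at h
  refine ⟨SeqL2.mk _ h, ?_⟩
  refine ae_eq_of_fourierCoef_eq hL hf.periodic (synth_periodic hL.ne' _) hf.memLp
    (memLp_of_continuous (continuous_synth hm _)) fun n => ?_
  have hn : (sobWeight L s n : ℂ) ≠ 0 := by exact_mod_cast (hm.pos n).ne'
  rw [fourierCoef_synth hL.ne' hm, SeqL2.mk_apply, mul_div_cancel_left₀ _ hn]

end sobolev
end NLS

/-! ### The interaction picture: flow, uniqueness and equivalence with the weak equation -/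

namespace NLS

/-- The phases of the free Schrödinger flow after time `t`. -/
noncomputable def phase (L t : ℝ) (n : ℤ) : ℝ := freq L n ^ 2 * t

@[simp] theorem rot_phase_zero (L : ℝ) (x : SeqL2) : rot (phase L 0) x = x := by
  apply SeqL2.ext; intro n; simp [phase]

@[simp] theorem rot_neg_phase_zero (L : ℝ) (x : SeqL2) : rot (-phase L 0) x = x := by
  apply SeqL2.ext; intro n; simp [phase]

theorem continuousOn_rot_phase {L t₀ : ℝ} {J : Set ℝ} {x : ℝ → SeqL2} (hx : ContinuousOn x J) :
    ContinuousOn (fun t => rot (phase L (t - t₀)) (x t)) J := fun t ht => by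
  refine tendsto_rot (fun n => ?_) (hx t ht)
  have : Continuous fun t => phase L (t - t₀) n := by unfold phase; fun_prop
  exact this.continuousWithinAt

theorem continuousOn_rot_neg_phase {L t₀ : ℝ} {J : Set ℝ} {x : ℝ → SeqL2}
    (hx : ContinuousOn x J) :
    ContinuousOn (fun t => rot (-phase L (t - t₀)) (x t)) J := fun t ht => by
  refine tendsto_rot (fun n => ?_) (hx t ht)
  have : Continuous fun t => (-phase L (t - t₀)) n := by
    simp only [Pi.neg_apply, phase]; fun_prop
  exact this.continuousWithinAt

theorem hasDerivAt_exp_phase (L t₀ t : ℝ) (n : ℤ) :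
    HasDerivAt (fun τ : ℝ => Complex.exp (phase L (τ - t₀) n * Complex.I))
      (Complex.I * (freq L n : ℂ) ^ 2 * Complex.exp (phase L (t - t₀) n * Complex.I)) t := by
  have h : HasDerivAt (fun τ : ℝ => ((phase L (τ - t₀) n : ℝ) : ℂ) * Complex.I)
      (Complex.I * (freq L n : ℂ) ^ 2) t := by
    have := ((((hasDerivAt_id t).sub_const t₀).const_mul (freq L n ^ 2)).ofReal_comp).mul_const
      Complex.I
    refine this.congr_deriv ?_
    push_cast; ring
  have := h.cexp
  rwa [mul_comm] at this

/-- The vector field of the cubic Schrödinger equation in the interaction picture. -/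
noncomputable def field {m : ℤ → ℝ} (hm : AlgWeight m) (L t₀ t : ℝ) (v : SeqL2) : SeqL2 :=
  Complex.I • rot (phase L (t - t₀)) (hm.cubic (rot (-phase L (t - t₀)) v))

section field
variable {m : ℤ → ℝ} (hm : AlgWeight m) {L t₀ : ℝ}

theorem exists_field_lipschitz (L t₀ : ℝ) : ∃ C : ℝ, 0 < C ∧ ∀ (M t : ℝ) (x y : SeqL2),
    ‖x‖ ≤ M → ‖y‖ ≤ M →
      ‖field hm L t₀ t x - field hm L t₀ t y‖ ≤ C * M ^ 2 * ‖x - y‖ := by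
  obtain ⟨C, hC0, hC⟩ := hm.exists_cubic_lipschitz
  refine ⟨C, hC0, fun M t x y hx hy => ?_⟩
  rw [field, field, ← smul_sub, ← rot_sub, norm_smul, norm_rot, Complex.norm_I, one_mul]
  refine (hC M _ _ (by simpa using hx) (by simpa using hy)).trans (le_of_eq ?_)
  rw [← rot_sub, norm_rot]

@[simp] theorem field_zero (t : ℝ) : field hm L t₀ t 0 = 0 := by
  rw [← norm_eq_zero, field, norm_smul, norm_rot]
  have : rot (-phase L (t - t₀)) 0 = 0 := by rw [← norm_eq_zero, norm_rot, norm_zero]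
  rw [this, hm.cubic_zero, norm_zero, mul_zero]

theorem continuousOn_field {J : Set ℝ} {v : ℝ → SeqL2} (hv : ContinuousOn v J) :
    ContinuousOn (fun t => field hm L t₀ t (v t)) J :=
  (continuous_const_smul Complex.I).comp_continuousOn (continuousOn_rot_phase
    (hm.continuous_cubic.comp_continuousOn (continuousOn_rot_neg_phase hv)))

/-- Continuity on a compact interval confines both curves to one ball, where the field is Lipschitz
uniformly in time; uniqueness is then applied on each side of the initial time. -/
theorem field_unique {p q : ℝ} (ht₀ : t₀ ∈ Icc p q) {v w : ℝ → SeqL2}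
    (hv : ∀ t ∈ Icc p q, HasDerivWithinAt v (field hm L t₀ t (v t)) (Icc p q) t)
    (hw : ∀ t ∈ Icc p q, HasDerivWithinAt w (field hm L t₀ t (w t)) (Icc p q) t)
    (h : v t₀ = w t₀) : EqOn v w (Icc p q) := by
  obtain ⟨C, hC0, hC⟩ := exists_field_lipschitz hm L t₀
  have hvc : ContinuousOn v (Icc p q) := fun t ht => (hv t ht).continuousWithinAt
  have hwc : ContinuousOn w (Icc p q) := fun t ht => (hw t ht).continuousWithinAt
  obtain ⟨M₁, hM₁⟩ := isCompact_Icc.exists_bound_of_continuousOn hvc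
  obtain ⟨M₂, hM₂⟩ := isCompact_Icc.exists_bound_of_continuousOn hwc
  set M := max M₁ M₂
  have hlip : ∀ t, LipschitzOnWith (C * M ^ 2).toNNReal (field hm L t₀ t) {x | ‖x‖ ≤ M} := by
    intro t
    refine LipschitzOnWith.of_dist_le_mul fun x hx y hy => ?_
    rw [Real.coe_toNNReal _ (by positivity), dist_eq_norm, dist_eq_norm]
    exact hC M t x y hx hy
  have hvM : ∀ t ∈ Icc p q, v t ∈ {x | ‖x‖ ≤ M} := fun t ht => (hM₁ t ht).trans (le_max_left _ _)
  have hwM : ∀ t ∈ Icc p q, w t ∈ {x | ‖x‖ ≤ M} := fun t ht => (hM₂ t ht).trans (le_max_right _ _)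
  have hl : Icc p t₀ ⊆ Icc p q := Icc_subset_Icc_right ht₀.2
  have hr : Icc t₀ q ⊆ Icc p q := Icc_subset_Icc_left ht₀.1
  have hl' : ∀ t ∈ Ioc p t₀, t ∈ Icc p q := fun t ht => hl (Ioc_subset_Icc_self ht)
  have hr' : ∀ t ∈ Ico t₀ q, t ∈ Icc p q := fun t ht => hr (Ico_subset_Icc_self ht)
  have nl : ∀ t ∈ Ioc p t₀, Icc p q ∈ 𝓝[≤] t := fun t ht =>
    Icc_mem_nhdsLE_of_mem ⟨ht.1, ht.2.trans ht₀.2⟩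
  have nr : ∀ t ∈ Ico t₀ q, Icc p q ∈ 𝓝[≥] t := fun t ht =>
    Icc_mem_nhdsGE_of_mem ⟨ht₀.1.trans ht.1, ht.2⟩
  rw [← Icc_union_Icc_eq_Icc ht₀.1 ht₀.2]
  refine EqOn.union ?_ ?_
  · exact ODE_solution_unique_of_mem_Icc_left (fun t _ => hlip t) (hvc.mono hl)
      (fun t ht => (hv t (hl' t ht)).mono_of_mem_nhdsWithin (nl t ht))
      (fun t ht => hvM t (hl' t ht)) (hwc.mono hl)
      (fun t ht => (hw t (hl' t ht)).mono_of_mem_nhdsWithin (nl t ht))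
      (fun t ht => hwM t (hl' t ht)) h
  · exact ODE_solution_unique_of_mem_Icc_right (fun t _ => hlip t) (hvc.mono hr)
      (fun t ht => (hv t (hr' t ht)).mono_of_mem_nhdsWithin (nr t ht))
      (fun t ht => hvM t (hr' t ht)) (hwc.mono hr)
      (fun t ht => (hw t (hr' t ht)).mono_of_mem_nhdsWithin (nr t ht))
      (fun t ht => hwM t (hr' t ht)) h

open scoped NNReal in
/-- Local existence for the interaction picture, uniformly over bounded sets of data, with
Lipschitz dependence on the data. -/
theorem exists_flow (L t₀ : ℝ) {R : ℝ} (hR : 0 ≤ R) : ∃ T : ℝ, 0 < T ∧ ∃ α : SeqL2 → ℝ → SeqL2,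
    (∀ x, ‖x‖ ≤ R → α x t₀ = x ∧ ∀ t ∈ Icc (t₀ - T) (t₀ + T),
      HasDerivWithinAt (α x) (field hm L t₀ t (α x t)) (Icc (t₀ - T) (t₀ + T)) t) ∧
    ∃ C : ℝ, 0 < C ∧ ∀ x y, ‖x‖ ≤ R → ‖y‖ ≤ R → ∀ t ∈ Icc (t₀ - T) (t₀ + T),
      ‖α x t - α y t‖ ≤ C * ‖x - y‖ := by
  obtain ⟨C, hC0, hC⟩ := exists_field_lipschitz hm L t₀
  -- On the ball of radius R + 1 the field has Lipschitz constant `K` and, vanishing at 0, norm at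
  -- most `B`. The choice of `T` gives B T ≤ 1, so curves starting in the ball of radius R stay in
  -- the larger one.
  set K : ℝ := C * (R + 1) ^ 2
  have hK : 0 ≤ K := by positivity
  set B : ℝ := K * (R + 1)
  have hB : 0 ≤ B := by positivity
  set T : ℝ := 1 / (B + 1)
  have hT : 0 < T := by positivity
  have hmem : t₀ ∈ Icc (t₀ - T) (t₀ + T) := ⟨by linarith, by linarith⟩
  have hball : ∀ x : SeqL2, x ∈ Metric.closedBall (0 : SeqL2) ((R + 1).toNNReal : ℝ) →
      ‖x‖ ≤ R + 1 := fun x hx => by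
    rwa [mem_closedBall_zero_iff, Real.coe_toNNReal _ (by linarith)] at hx
  have hPL : IsPicardLindelof (field hm L t₀) (⟨t₀, hmem⟩ : Icc (t₀ - T) (t₀ + T)) 0
      (R + 1).toNNReal R.toNNReal B.toNNReal K.toNNReal :=
    { lipschitzOnWith := fun t _ => by
        refine LipschitzOnWith.of_dist_le_mul fun x hx y hy => ?_
        rw [Real.coe_toNNReal _ hK, dist_eq_norm, dist_eq_norm]
        exact hC (R + 1) t x y (hball x hx) (hball y hy)
      continuousOn := fun x _ => continuousOn_field hm continuousOn_const
      norm_le := fun t _ x hx => by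
        rw [Real.coe_toNNReal _ hB]
        have := hC (R + 1) t x 0 (hball x hx) (by simp; linarith)
        rw [field_zero, sub_zero, sub_zero] at this
        exact this.trans (mul_le_mul_of_nonneg_left (hball x hx) hK)
      mul_max_le := by
        rw [Real.coe_toNNReal _ hB, Real.coe_toNNReal _ hR, Real.coe_toNNReal _ (by linarith)]
        simp only [add_sub_cancel_left, sub_sub_cancel, max_self]
        rw [mul_one_div, div_le_one (by linarith)]
        linarith }
  obtain ⟨α, h1, C', h2⟩ := hPL.exists_forall_mem_closedBall_eq_hasDerivWithinAt_lipschitzOnWith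
  have hin : ∀ x : SeqL2, ‖x‖ ≤ R → x ∈ Metric.closedBall (0 : SeqL2) (R.toNNReal : ℝ) :=
    fun x hx => by rwa [mem_closedBall_zero_iff, Real.coe_toNNReal _ hR]
  -- `C'` is only nonnegative; adding 1 makes the constant strictly positive.
  refine ⟨T, hT, α, fun x hx => h1 x (hin x hx), C' + 1, by positivity, fun x y hx hy t ht => ?_⟩
  have := (h2 t ht).dist_le_mul x (hin x hx) y (hin y hy)
  rw [dist_eq_norm, dist_eq_norm] at this
  exact this.trans (mul_le_mul_of_nonneg_right (by simp) (norm_nonneg _))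

theorem SolvesNLSOn.mono {J J' : Set ℝ} {u : ℝ → ℝ → ℂ} (h : SolvesNLSOn L J u) (hJ : J' ⊆ J) :
    SolvesNLSOn L J' u := fun ψ hψ hψp t ht => by
  obtain ⟨d, hd, he⟩ := h ψ hψ hψp t (hJ ht)
  exact ⟨d, hd.mono hJ, he⟩

/-- Passing from the weak form of the equation to the interaction picture. -/
theorem SolvesNLSOn.hasDerivWithinAt (hL : L ≠ 0) {p q : ℝ} {u : ℝ → ℝ → ℂ}
    (hu : SolvesNLSOn L (Icc p q) u) {X : ℝ → SeqL2} (hX : ContinuousOn X (Icc p q))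
    (hae : ∀ t ∈ Icc p q, u t =ᵐ[volume] synth L m (X t)) :
    ∀ t ∈ Icc p q, HasDerivWithinAt (fun t => rot (phase L (t - t₀)) (X t))
      (field hm L t₀ t (rot (phase L (t - t₀)) (X t))) (Icc p q) t := by
  apply SeqL2.hasDerivWithinAt_of_coord
    (continuousOn_field hm (continuousOn_rot_phase hX))
  intro n t ht
  have hL' : (L : ℂ) ≠ 0 := by exact_mod_cast hL
  have hn : (m n : ℂ) ≠ 0 := by exact_mod_cast (hm.pos n).ne'
  obtain ⟨d, hd, he⟩ := hu (eChar L (-n)) (contDiff_eChar L (-n)) (eChar_periodic hL (-n)) t ht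
  have hcoef : ∀ τ ∈ Icc p q, ∫ x in (0 : ℝ)..L, u τ x * eChar L (-n) x =
      L * (X τ n / m n) := fun τ hτ => by
    simp only [mul_comm (u τ _)]
    rw [integral_eChar_mul hL, fourierCoef_congr (hae τ hτ), fourierCoef_synth hL hm]
  have hcub : ∫ x in (0 : ℝ)..L, (‖u t x‖ ^ 2 : ℝ) * u t x * eChar L (-n) x =
      L * (hm.cubic (X t) n / m n) := by
    simp only [mul_comm _ (eChar L (-n) _)]
    have : (fun x => ((‖u t x‖ ^ 2 : ℝ) : ℂ) * u t x) =ᵐ[volume]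
        synth L m (hm.cubic (X t)) := by
      filter_upwards [hae t ht] with x hx
      rw [synth_cubic, hx]
    rw [integral_eChar_mul hL, fourierCoef_congr this, fourierCoef_synth hL hm]
  have hxx : ∫ x in (0 : ℝ)..L, u t x * deriv (deriv (eChar L (-n))) x =
      -(freq L n : ℂ) ^ 2 * (L * (X t n / m n)) := by
    rw [deriv_deriv_eChar, ← hcoef t ht, ← intervalIntegral.integral_const_mul]
    congr 1; ext x; rw [freq_neg]; push_cast; ring
  rw [hcub, hxx] at he
  have hdX : HasDerivWithinAt (fun τ => X τ n)
      (Complex.I * (hm.cubic (X t) n - (freq L n : ℂ) ^ 2 * X t n)) (Icc p q) t := by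
    have h1 : HasDerivWithinAt (fun τ : ℝ => (m n / L : ℂ) * (L * (X τ n / m n)))
        (m n / L * d) (Icc p q) t :=
      (hd.congr (fun τ hτ => (hcoef τ hτ).symm) (hcoef t ht).symm).const_mul _
    -- The weak equation tested on one character, solved for the time derivative.
    have h2 : (m n / L * d : ℂ) = Complex.I * (hm.cubic (X t) n - (freq L n : ℂ) ^ 2 * X t n) := by
      field_simp at he ⊢
      linear_combination (-Complex.I) * he + d * m n * Complex.I_sq
    rw [h2] at h1
    refine h1.congr (fun τ _ => ?_) ?_ <;> field_simp
  -- The derivative of the phase contributes iω_n² times the coordinate, which cancels the Laplacian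
  -- term and leaves only the nonlinearity.
  have := (hasDerivAt_exp_phase L t₀ t n).hasDerivWithinAt.mul hdX
  refine this.congr_deriv ?_
  rw [field, rot_neg_rot, lp.coeFn_smul, Pi.smul_apply, rot_apply, smul_eq_mul]
  ring

/-- Two integrations by parts, whose boundary terms cancel by periodicity. -/
theorem integral_eChar_mul_deriv_deriv (hL : L ≠ 0) {ψ : ℝ → ℂ} (hψ : ContDiff ℝ ∞ ψ)
    (hp : Function.Periodic ψ L) (n : ℤ) :
    ∫ x in (0 : ℝ)..L, eChar L n x * deriv (deriv ψ) x =
      -(freq L n : ℂ) ^ 2 * ∫ x in (0 : ℝ)..L, eChar L n x * ψ x := by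
  have hstep : ∀ φ : ℝ → ℂ, ContDiff ℝ ∞ φ → Function.Periodic φ L →
      ∫ x in (0 : ℝ)..L, eChar L n x * deriv φ x =
        -(Complex.I * freq L n) * ∫ x in (0 : ℝ)..L, eChar L n x * φ x := by
    intro φ hφ hφp
    have hd := hφ.continuous_deriv (by simp)
    rw [intervalIntegral.integral_mul_deriv_eq_deriv_mul
      (u' := fun x => Complex.I * freq L n * eChar L n x)
      (fun x _ => hasDerivAt_eChar L n x)
      (fun x _ => (hφ.differentiable (by simp) x).hasDerivAt)
      (Continuous.intervalIntegrable (by fun_prop) _ _) (hd.intervalIntegrable _ _)]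
    have e1 := eChar_periodic hL n 0
    have e2 := hφp 0
    rw [zero_add] at e1 e2
    rw [e1, e2, sub_self, zero_sub, neg_mul, ← intervalIntegral.integral_const_mul]
    simp only [mul_assoc]
  have hψ' : ContDiff ℝ ∞ (deriv ψ) := by
    have := (contDiff_succ_iff_deriv (n := ∞) (f := ψ) (𝕜 := ℝ)).1 (by simpa using hψ)
    exact this.2.2
  have hp' : Function.Periodic (deriv ψ) L := fun x => by
    rw [← deriv_comp_add_const]
    congr 1; ext y; exact hp y
  rw [hstep _ hψ' hp', hstep _ hψ hp]
  linear_combination (freq L n : ℂ) ^ 2 * (∫ x in (0 : ℝ)..L, eChar L n x * ψ x) * Complex.I_sq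

/-- The sequence representing integration against `ψ` on weighted Fourier coefficients. -/
theorem exists_dual (hm : AlgWeight m) (L : ℝ) {ψ : ℝ → ℂ} (hψ : Continuous ψ) :
    ∃ y : SeqL2, (∀ n, y n = starRingEnd ℂ (∫ x in (0 : ℝ)..L, eChar L n x * ψ x) / m n) ∧
      ∀ x : SeqL2, ∫ ξ in (0 : ℝ)..L, synth L m x ξ * ψ ξ = inner ℂ y x := by
  obtain ⟨C, hC⟩ := isCompact_uIcc.exists_bound_of_continuousOn (s := uIcc 0 L) hψ.continuousOn
  have hb : ∀ n, ‖∫ x in (0 : ℝ)..L, eChar L n x * ψ x‖ ≤ C * |L - 0| := fun n => by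
    refine intervalIntegral.norm_integral_le_of_norm_le_const fun x hx => ?_
    simpa using hC x (uIoc_subset_uIcc hx)
  -- Boundedness of the coefficients of `ψ` is enough, since the inverse weights are square
  -- summable.
  have hs : Summable fun n =>
      ‖starRingEnd ℂ (∫ x in (0 : ℝ)..L, eChar L n x * ψ x) / m n‖ ^ 2 := by
    refine Summable.of_nonneg_of_le (fun _ => by positivity) (fun n => ?_)
      (hm.summable.mul_left ((C * |L - 0|) ^ 2))
    rw [norm_div, RCLike.norm_conj, div_eq_mul_inv, mul_pow, Complex.norm_real,
      Real.norm_of_nonneg (hm.pos n).le]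
    gcongr
    exact hb n
  refine ⟨SeqL2.mk _ hs, fun n => rfl, fun x => ?_⟩
  rw [lp.inner_eq_tsum, ← (hasSum_integral_synth_mul hm x hψ).tsum_eq]
  congr 1; ext n
  rw [SeqL2.mk_apply, RCLike.inner_apply, map_div₀, Complex.conj_conj, Complex.conj_ofReal]
  ring

/-- Solutions in the interaction picture solve the equation weakly. -/
theorem solvesNLSOn_of_hasDerivWithinAt (hL : L ≠ 0) {p q : ℝ} {v : ℝ → SeqL2}
    (hv : ∀ t ∈ Icc p q, HasDerivWithinAt v (field hm L t₀ t (v t)) (Icc p q) t) :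
    SolvesNLSOn L (Icc p q) (fun t => synth L m (rot (-phase L (t - t₀)) (v t))) := by
  intro ψ hψ hp t ht
  have hψ'' : Continuous (deriv (deriv ψ)) := by
    have h1 := (contDiff_succ_iff_deriv (n := ∞) (f := ψ) (𝕜 := ℝ)).1 (by simpa using hψ)
    exact h1.2.2.continuous_deriv (by simp)
  obtain ⟨y, hy, hyi⟩ := exists_dual hm L hψ.continuous
  obtain ⟨z, hz, hzi⟩ := exists_dual hm L hψ''
  have hyz : ∀ n, z n = -(freq L n : ℂ) ^ 2 * y n := fun n => by
    rw [hz, hy, integral_eChar_mul_deriv_deriv hL hψ hp]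
    simp only [map_mul, map_neg, map_pow, Complex.conj_ofReal]; ring
  have hin : ∀ (θ : ℤ → ℝ) (a b : SeqL2), inner ℂ a (rot (-θ) b) = inner ℂ (rot θ a) b := by
    intro θ a b
    rw [lp.inner_eq_tsum, lp.inner_eq_tsum]
    congr 1; ext n
    rw [RCLike.inner_apply, RCLike.inner_apply, rot_apply, rot_apply, map_mul, ← Complex.exp_conj]
    simp; ring
  have hin' : ∀ (θ : ℤ → ℝ) (a b : SeqL2), inner ℂ (rot θ a) (rot θ b) = inner ℂ a b := by
    intro θ a b
    rw [← hin, rot_neg_rot]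
  -- The rotation of `v` need not be differentiable in ℓ², but that of `y` is: multiplying `y` by
  -- the squared frequencies gives, up to sign, `z`, which is still in ℓ². This is where smoothness
  -- of `ψ` is used.
  have hyd : ∀ t ∈ Icc p q, HasDerivWithinAt (fun t => rot (phase L (t - t₀)) y)
      (-Complex.I • rot (phase L (t - t₀)) z) (Icc p q) t := by
    apply SeqL2.hasDerivWithinAt_of_coord
    · exact (continuous_const_smul (-Complex.I)).comp_continuousOn
        (continuousOn_rot_phase continuousOn_const)
    · intro n t _
      have := (hasDerivAt_exp_phase L t₀ t n).hasDerivWithinAt (s := Icc p q) |>.mul_const (y n)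
      refine this.congr_deriv ?_
      rw [lp.coeFn_smul, Pi.smul_apply, rot_apply, smul_eq_mul, hyz]
      ring
  set X := rot (-phase L (t - t₀)) (v t) with hXdef
  have hd := (hyd t ht).inner ℂ (hv t ht)
  refine ⟨Complex.I * (inner ℂ y (hm.cubic X) + inner ℂ z X), ?_, ?_⟩
  · simp only [hyi, hin]
    refine hd.congr_deriv ?_
    rw [field, inner_smul_right, hin', inner_smul_left, ← hin]
    simp; ring
  · have hcub : ∀ x, ((‖synth L m X x‖ ^ 2 : ℝ) : ℂ) * synth L m X x = synth L m (hm.cubic X) x :=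
      fun x => (synth_cubic hm X x).symm
    simp only [← hXdef, hcub, hyi, hzi]
    linear_combination (inner ℂ y (hm.cubic X) + inner ℂ z X) * Complex.I_sq

end field
end NLS

/-! ### Fourier series of the breather -/

namespace NLS

/-- The Poisson kernel expansion of `1 / (1 - r cos θ)`, `r = 2q / (1 + q²)`. -/
theorem hasSum_poisson {q : ℝ} (hq0 : 0 ≤ q) (hq1 : q < 1) (z : ℂ) (hz : ‖z‖ = 1) :
    HasSum (fun j : ℤ => (q : ℂ) ^ j.natAbs * z ^ j)
      ((1 - q ^ 2) / (1 + q ^ 2 - q * (z + z⁻¹)) : ℂ) := by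
  have hz0 : z ≠ 0 := by rintro rfl; simp at hz
  have h1 : ‖(q : ℂ) * z‖ < 1 := by simpa [hz, abs_of_nonneg hq0] using hq1
  have h2 : ‖(q : ℂ) * z⁻¹‖ < 1 := by simpa [hz, abs_of_nonneg hq0] using hq1
  have n1 : (1 - q * z : ℂ) ≠ 0 := fun h => by
    rw [sub_eq_zero] at h; rw [← h] at h1; simp at h1
  have n2 : (1 - q * z⁻¹ : ℂ) ≠ 0 := fun h => by
    rw [sub_eq_zero] at h; rw [← h] at h2; simp at h2
  have g1 := hasSum_geometric_of_norm_lt_one h1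
  -- The extra factor q z⁻¹ is there because the negative half of the series starts at index -1.
  have g2 := (hasSum_geometric_of_norm_lt_one h2).mul_left ((q : ℂ) * z⁻¹)
  have key : HasSum (fun j : ℤ => (q : ℂ) ^ j.natAbs * z ^ j)
      ((1 - q * z : ℂ)⁻¹ + q * z⁻¹ * (1 - q * z⁻¹)⁻¹) := by
    refine HasSum.of_nat_of_neg_add_one ?_ ?_
    · simpa [mul_pow] using g1
    · refine g2.congr_fun fun n => ?_
      have : (-((n : ℤ) + 1)).natAbs = n + 1 := by omega
      rw [this, zpow_neg, ← Nat.cast_succ, zpow_natCast, ← inv_pow, Nat.succ_eq_add_one]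
      ring
  convert key using 1
  have n3 : (1 + q ^ 2 - q * (z + z⁻¹) : ℂ) = (1 - q * z) * (1 - q * z⁻¹) := by
    field_simp; ring
  rw [n3, div_eq_iff (mul_ne_zero n1 n2), add_mul]
  have e1 : (1 - q * z : ℂ)⁻¹ * ((1 - q * z) * (1 - q * z⁻¹)) = 1 - q * z⁻¹ :=
    inv_mul_cancel_left₀ n1 _
  have e2 : q * z⁻¹ * (1 - q * z⁻¹)⁻¹ * ((1 - q * z) * (1 - q * z⁻¹)) = q * z⁻¹ * (1 - q * z) := by
    rw [mul_assoc, mul_comm (1 - q * z : ℂ), inv_mul_cancel_left₀ n2]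
  rw [e1, e2]
  field_simp; ring

/-- A polynomial weight times a geometric sequence is square summable. -/
theorem summable_sobWeight_sq_mul_geometric (L s : ℝ) (k : ℕ) {q : ℝ} (hq0 : 0 ≤ q)
    (hq1 : q < 1) : Summable fun j : ℤ => (sobWeight L s (k * j) * q ^ j.natAbs) ^ 2 := by
  -- A natural exponent above s turns the weight into a polynomial bound. The summand without a
  -- power of |j| in that bound covers j = 0.
  obtain ⟨N, hN⟩ := exists_nat_ge s
  set B : ℝ := 1 + freq L k ^ 2
  have hB : 1 ≤ B := by simp only [B]; nlinarith [sq_nonneg (freq L k)]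
  have hq2 : ‖q ^ 2‖ < 1 := by
    rw [Real.norm_of_nonneg (by positivity)]; nlinarith
  have hbase := ((summable_pow_mul_geometric_of_norm_lt_one (2 * N) hq2).mul_left
    ((4 * B) ^ N)).add ((summable_geometric_of_norm_lt_one hq2).mul_left ((4 * B) ^ N))
  have hb : ∀ j : ℤ, (sobWeight L s (k * j) * q ^ j.natAbs) ^ 2 ≤
      (4 * B) ^ N * ((j.natAbs : ℝ) ^ (2 * N) * (q ^ 2) ^ j.natAbs)
        + (4 * B) ^ N * (q ^ 2) ^ j.natAbs := fun j => by
    have hf : freq L (k * j) ^ 2 = freq L k ^ 2 * (j.natAbs : ℝ) ^ 2 := by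
      have : ((j.natAbs : ℝ)) ^ 2 = (j : ℝ) ^ 2 := by
        rw [Nat.cast_natAbs, Int.cast_abs, sq_abs]
      rw [this]; simp only [freq]; push_cast; ring
    have hw : sobWeight L s (k * j) ^ 2 ≤ (4 * B) ^ N * ((j.natAbs : ℝ) ^ (2 * N) + 1) := by
      rw [sobWeight_sq, hf]
      calc (1 + freq L k ^ 2 * (j.natAbs : ℝ) ^ 2) ^ s
          ≤ (1 + freq L k ^ 2 * (j.natAbs : ℝ) ^ 2) ^ (N : ℝ) :=
            Real.rpow_le_rpow_of_exponent_le (le_add_of_nonneg_right (by positivity)) hN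
        _ = (1 + freq L k ^ 2 * (j.natAbs : ℝ) ^ 2) ^ N := Real.rpow_natCast _ _
        _ ≤ (4 * B) ^ N * ((j.natAbs : ℝ) ^ (2 * N) + 1) := by
            rcases Nat.eq_zero_or_pos j.natAbs with h0 | h0
            · rw [h0]
              have : (1 : ℝ) ≤ (4 * B) ^ N := one_le_pow₀ (by linarith)
              simp only [Nat.cast_zero, ne_eq, OfNat.ofNat_ne_zero, not_false_eq_true, zero_pow,
                mul_zero, add_zero, one_pow]
              have h00 : (0 : ℝ) ≤ 0 ^ (2 * N) := by positivity
              nlinarith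
            · have h1 : (1 : ℝ) ≤ j.natAbs := by exact_mod_cast h0
              have h2 : (1 : ℝ) ≤ (j.natAbs : ℝ) ^ 2 := one_le_pow₀ h1
              have h3 : 1 + freq L k ^ 2 * (j.natAbs : ℝ) ^ 2 ≤ 4 * B * (j.natAbs : ℝ) ^ 2 := by
                simp only [B]; nlinarith [sq_nonneg (freq L k)]
              calc _ ≤ (4 * B * (j.natAbs : ℝ) ^ 2) ^ N := pow_le_pow_left₀ (by positivity) h3 N
                _ = (4 * B) ^ N * (j.natAbs : ℝ) ^ (2 * N) := by rw [mul_pow, ← pow_mul]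
                _ ≤ _ := by gcongr; linarith
    calc _ = sobWeight L s (k * j) ^ 2 * (q ^ 2) ^ j.natAbs := by
          rw [mul_pow, ← pow_mul, ← pow_mul, mul_comm 2]
      _ ≤ ((4 * B) ^ N * ((j.natAbs : ℝ) ^ (2 * N) + 1)) * (q ^ 2) ^ j.natAbs := by gcongr
      _ = _ := by ring
  refine Summable.of_nonneg_of_le (fun _ => by positivity) hb ?_
  apply Summable.of_nat_of_neg
  · simpa using hbase
  · simpa using hbase

section breather
variable {a L : ℝ} {k : ℕ}

theorem alpha_pos (ha1 : a < 1 / 2) : 0 < alpha a := Real.sqrt_pos.2 (by linarith)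

theorem breather_period_pos (ha1 : a < 1 / 2) (hk : 0 < k)
    (hL : L = k * (2 * Real.pi / alpha a)) : 0 < L := by
  have := alpha_pos ha1
  have : (0 : ℝ) < k := by exact_mod_cast hk
  rw [hL]; positivity

theorem eChar_mul_index (ha1 : a < 1 / 2) (hk : 0 < k)
    (hL : L = k * (2 * Real.pi / alpha a)) (j : ℤ) (x : ℝ) :
    eChar L (k * j) x = Complex.exp (Complex.I * ((alpha a * x : ℝ) : ℂ)) ^ j := by
  have h1 := alpha_pos ha1
  have h2 : (0 : ℝ) < k := by exact_mod_cast hk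
  have : freq L (k * j) = j * alpha a := by
    rw [freq, hL]; push_cast; field_simp
  rw [eChar, this, ← Complex.exp_int_mul]
  congr 1; push_cast; ring

/-- The modulation parameter of the breather. -/
noncomputable def breatherMod (a t : ℝ) : ℝ := Real.sqrt (2 * a) / Real.cosh (beta a * t)

/-- The ratio of the geometric Fourier series of the breather. -/
noncomputable def breatherRatio (a t : ℝ) : ℝ :=
  breatherMod a t / (1 + Real.sqrt (1 - breatherMod a t ^ 2))

theorem sqrt_two_mul_lt_one (ha1 : a < 1 / 2) : Real.sqrt (2 * a) < 1 := by
  rw [Real.sqrt_lt' one_pos]; linarith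

theorem breatherMod_nonneg (a t : ℝ) : 0 ≤ breatherMod a t := by
  have := Real.cosh_pos (beta a * t)
  unfold breatherMod; positivity

theorem breatherMod_le (a t : ℝ) : breatherMod a t ≤ Real.sqrt (2 * a) :=
  div_le_self (Real.sqrt_nonneg _) (Real.one_le_cosh _)

theorem breatherMod_lt_one (ha1 : a < 1 / 2) (t : ℝ) : breatherMod a t < 1 :=
  (breatherMod_le a t).trans_lt (sqrt_two_mul_lt_one ha1)

theorem breatherRatio_nonneg (a t : ℝ) : 0 ≤ breatherRatio a t := by
  have := breatherMod_nonneg a t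
  unfold breatherRatio; positivity

/-- A bound independent of t: it supplies a single geometric majorant for all times. -/
theorem breatherRatio_le (a t : ℝ) : breatherRatio a t ≤ Real.sqrt (2 * a) :=
  (div_le_self (breatherMod_nonneg a t) (by linarith [Real.sqrt_nonneg (1 - breatherMod a t ^ 2)])).trans
    (breatherMod_le a t)

theorem continuous_breatherMod (a : ℝ) : Continuous (breatherMod a) := by
  unfold breatherMod
  exact continuous_const.div (by fun_prop) fun t => (Real.cosh_pos _).ne'

theorem continuous_breatherRatio (a : ℝ) : Continuous (breatherRatio a) := by
  unfold breatherRatio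
  have := continuous_breatherMod a
  refine this.div (by fun_prop) fun t => ?_
  have := Real.sqrt_nonneg (1 - breatherMod a t ^ 2)
  positivity

/-- With r the modulation, the ratio q is a root of r q² - 2q + r = 0, so that 1 + q² - 2q cos θ =
(1 + q²)(1 - r cos θ): the breather's denominator becomes a Poisson denominator. -/
theorem breatherRatio_spec (ha1 : a < 1 / 2) (t : ℝ) :
    2 * breatherRatio a t = breatherMod a t * (1 + breatherRatio a t ^ 2) := by
  have h0 := breatherMod_nonneg a t
  have h1 := breatherMod_lt_one ha1 t
  have hs := Real.sq_sqrt (show 0 ≤ 1 - breatherMod a t ^ 2 by nlinarith)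
  have hs0 := Real.sqrt_nonneg (1 - breatherMod a t ^ 2)
  unfold breatherRatio
  set r := breatherMod a t
  set S := Real.sqrt (1 - r ^ 2)
  have : 1 + S ≠ 0 := by positivity
  field_simp
  linear_combination (-r) * hs

/-- The common factor of the Fourier coefficients of the breather. -/
noncomputable def breatherAmp (a t : ℝ) : ℂ :=
  -Complex.exp (Complex.I * (t : ℂ)) *
    ((((alpha a) ^ 2 * Real.cosh (beta a * t) : ℝ) +
      Complex.I * ((beta a * Real.sinh (beta a * t) : ℝ) : ℂ)) / (Real.cosh (beta a * t) : ℝ)) *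
    ((((1 + breatherRatio a t ^ 2) / (1 - breatherRatio a t ^ 2) : ℝ)) : ℂ)

theorem breatherRatio_sq_lt_one (ha1 : a < 1 / 2) (t : ℝ) : breatherRatio a t ^ 2 < 1 := by
  have h0 := breatherRatio_nonneg a t
  have h1 := (breatherRatio_le a t).trans_lt (sqrt_two_mul_lt_one ha1)
  nlinarith

theorem continuous_breatherAmp (ha1 : a < 1 / 2) : Continuous (breatherAmp a) := by
  unfold breatherAmp
  refine Continuous.mul (Continuous.mul (by fun_prop) ?_) ?_
  · refine Continuous.div (by fun_prop) (by fun_prop) fun t => ?_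
    exact_mod_cast (Real.cosh_pos _).ne'
  · have := continuous_breatherRatio a
    refine Complex.continuous_ofReal.comp (Continuous.div (by fun_prop) (by fun_prop) fun t => ?_)
    linarith [breatherRatio_sq_lt_one ha1 t]

/-- The breather is e^{it} plus a multiple of the Poisson kernel in αx. Since L is k fundamental
periods, only frequencies with index divisible by k occur. -/
theorem akhmediev_hasSum (ha1 : a < 1 / 2) (hk : 0 < k)
    (hL : L = k * (2 * Real.pi / alpha a)) (t x : ℝ) :
    HasSum (fun j : ℤ => ((if j = 0 then Complex.exp (Complex.I * (t : ℂ)) else 0) +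
      breatherAmp a t * (breatherRatio a t : ℂ) ^ j.natAbs) * eChar L (k * j) x)
      (akhmediev a t x) := by
  set z := Complex.exp (Complex.I * ((alpha a * x : ℝ) : ℂ)) with hz
  have hz1 : ‖z‖ = 1 := by rw [hz, mul_comm, Complex.norm_exp_ofReal_mul_I]
  have hq0 := breatherRatio_nonneg a t
  have hq1 := (breatherRatio_le a t).trans_lt (sqrt_two_mul_lt_one ha1)
  have hP := (hasSum_poisson hq0 hq1 z hz1).mul_left (breatherAmp a t)
  have h0 : HasSum (fun j : ℤ => (if j = 0 then Complex.exp (Complex.I * (t : ℂ)) else 0))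
      (Complex.exp (Complex.I * (t : ℂ))) := hasSum_ite_eq 0 _
  have hcos : z + z⁻¹ = 2 * (Real.cos (alpha a * x) : ℂ) := by
    rw [hz, ← Complex.exp_neg, Complex.ofReal_cos, Complex.cos]
    ring_nf
  have hspec := breatherRatio_spec ha1 t
  have hsq := breatherRatio_sq_lt_one ha1 t
  have hch := Real.cosh_pos (beta a * t)
  have hden : Real.sqrt (2 * a) * Real.cos (alpha a * x) - Real.cosh (beta a * t) < 0 := by
    have h1 := Real.one_le_cosh (beta a * t)
    have h2 := sqrt_two_mul_lt_one ha1
    have h3 := Real.cos_le_one (alpha a * x)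
    nlinarith [Real.sqrt_nonneg (2 * a)]
  have hval : Complex.exp (Complex.I * (t : ℂ)) + breatherAmp a t *
      ((1 - (breatherRatio a t : ℂ) ^ 2) / (1 + (breatherRatio a t : ℂ) ^ 2 -
        breatherRatio a t * (z + z⁻¹))) = akhmediev a t x := by
    have hD : 1 + breatherRatio a t ^ 2 - breatherRatio a t * (2 * Real.cos (alpha a * x)) =
        -(1 + breatherRatio a t ^ 2) * (Real.sqrt (2 * a) * Real.cos (alpha a * x) -
          Real.cosh (beta a * t)) / Real.cosh (beta a * t) := by
      rw [breatherMod] at hspec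
      field_simp at hspec ⊢
      linear_combination (-Real.cos (alpha a * x)) * hspec
    have hD' : (1 + (breatherRatio a t : ℂ) ^ 2 - breatherRatio a t * (z + z⁻¹)) =
        ((-(1 + breatherRatio a t ^ 2) * (Real.sqrt (2 * a) * Real.cos (alpha a * x) -
          Real.cosh (beta a * t)) / Real.cosh (beta a * t) : ℝ) : ℂ) := by
      rw [← hD, hcos]; push_cast; ring
    have c1 : ((Real.cosh (beta a * t) : ℝ) : ℂ) ≠ 0 := by exact_mod_cast hch.ne'
    have c2 : ((Real.sqrt (2 * a) * Real.cos (alpha a * x) - Real.cosh (beta a * t) : ℝ) : ℂ) ≠ 0 :=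
      by exact_mod_cast hden.ne
    have c3 : ((1 - breatherRatio a t ^ 2 : ℝ) : ℂ) ≠ 0 := by
      exact_mod_cast (sub_pos.2 hsq).ne'
    have c4 : ((1 + breatherRatio a t ^ 2 : ℝ) : ℂ) ≠ 0 := by
      exact_mod_cast (by positivity : (0 : ℝ) < 1 + breatherRatio a t ^ 2).ne'
    rw [hD', akhmediev, breatherAmp]
    generalize Complex.exp (Complex.I * (t : ℂ)) = E
    generalize (((alpha a) ^ 2 * Real.cosh (beta a * t) : ℝ) +
      Complex.I * ((beta a * Real.sinh (beta a * t) : ℝ) : ℂ)) = P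
    rw [Complex.ofReal_div, Complex.ofReal_div, Complex.ofReal_mul, Complex.ofReal_neg]
    have e3 : (1 - (breatherRatio a t : ℂ) ^ 2) = ((1 - breatherRatio a t ^ 2 : ℝ) : ℂ) := by
      push_cast; ring
    rw [e3]
    generalize ((Real.sqrt (2 * a) * Real.cos (alpha a * x) - Real.cosh (beta a * t) : ℝ) : ℂ) = D
      at c2 ⊢
    generalize ((1 - breatherRatio a t ^ 2 : ℝ) : ℂ) = U at c3 ⊢
    generalize ((1 + breatherRatio a t ^ 2 : ℝ) : ℂ) = V at c4 ⊢
    generalize ((Real.cosh (beta a * t) : ℝ) : ℂ) = C at c1 ⊢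
    field_simp
  rw [← hval]
  refine (h0.add hP).congr_fun fun j => ?_
  rw [eChar_mul_index ha1 hk hL, ← hz]
  split_ifs with hj
  · subst hj; simp
  · ring

/-- The breather is a continuous curve in the Sobolev space. -/
theorem exists_breatherSeq (ha1 : a < 1 / 2) (hk : 0 < k)
    (hL : L = k * (2 * Real.pi / alpha a)) {s : ℝ} (hs : 1 / 2 < s) :
    ∃ A : ℝ → SeqL2, Continuous A ∧ ∀ t, akhmediev a t = synth L (sobWeight L s) (A t) := by
  have hLpos := breather_period_pos ha1 hk hL
  have hm := algWeight_sobWeight hLpos hs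
  set ι : ℤ → ℤ := fun j => k * j
  have hι : Function.Injective ι := fun i j h => by
    have : (k : ℤ) ≠ 0 := by exact_mod_cast hk.ne'
    exact mul_left_cancel₀ this h
  set c : ℝ → ℤ → ℂ := fun t j => (if j = 0 then Complex.exp (Complex.I * (t : ℂ)) else 0) +
      breatherAmp a t * (breatherRatio a t : ℂ) ^ j.natAbs
  set ρ := Real.sqrt (2 * a)
  have hρ0 : 0 ≤ ρ := Real.sqrt_nonneg _
  have hρ1 : ρ < 1 := sqrt_two_mul_lt_one ha1
  have hgeom := summable_sobWeight_sq_mul_geometric L s k hρ0 hρ1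
  have hc : ∀ t j, ‖c t j‖ ≤ (1 + ‖breatherAmp a t‖) * ρ ^ j.natAbs := fun t j => by
    refine (norm_add_le _ _).trans ?_
    rw [add_mul]
    refine add_le_add ?_ ?_
    · split_ifs with hj
      · subst hj; rw [mul_comm, Complex.norm_exp_ofReal_mul_I]; simp
      · rw [norm_zero, one_mul]; exact pow_nonneg hρ0 _
    · rw [norm_mul, norm_pow, Complex.norm_real, Real.norm_of_nonneg (breatherRatio_nonneg a t)]
      gcongr
      · exact breatherRatio_nonneg a t
      · exact breatherRatio_le a t
  -- Weighted coefficients over all indices: zero off the multiples of k.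
  set d : ℝ → ℤ → ℂ := fun t => Function.extend ι (fun j => sobWeight L s (ι j) * c t j) 0
  have hdι : ∀ t j, d t (ι j) = sobWeight L s (ι j) * c t j := fun t j => hι.extend_apply _ _ _
  have hd0 : ∀ t n, n ∉ range ι → d t n = 0 := fun t n hn => Function.extend_apply' _ _ _ hn
  have hwc : ∀ t j, ‖(sobWeight L s (ι j) * c t j : ℂ)‖ ≤
      (1 + ‖breatherAmp a t‖) * (sobWeight L s (ι j) * ρ ^ j.natAbs) := fun t j => by
    rw [norm_mul, Complex.norm_real, Real.norm_of_nonneg (hm.pos _).le, mul_left_comm]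
    exact mul_le_mul_of_nonneg_left (hc t j) (hm.pos _).le
  have hsum : ∀ t, Summable fun n => ‖d t n‖ ^ 2 := fun t => by
    rw [← hι.summable_iff fun n hn => by rw [hd0 t n hn]; simp]
    refine Summable.of_nonneg_of_le (fun _ => sq_nonneg _) (fun j => ?_)
      (hgeom.mul_left ((1 + ‖breatherAmp a t‖) ^ 2))
    rw [Function.comp_apply, hdι, ← mul_pow]
    exact pow_le_pow_left₀ (norm_nonneg _) (hwc t j) 2
  refine ⟨fun t => SeqL2.mk (d t) (hsum t), ?_, fun t => ?_⟩
  · rw [continuous_iff_continuousAt]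
    intro t
    have hamp := continuous_breatherAmp ha1
    have hrat := continuous_breatherRatio a
    set M := ‖breatherAmp a t‖ + 1
    have hev : ∀ᶠ τ in 𝓝 t, ‖breatherAmp a τ‖ ≤ M :=
      (hamp.norm.tendsto t).eventually_le_const (lt_add_one _)
    -- Near t the amplitude is at most `M`, so both sequences are bounded by (1 + M) times the
    -- weighted geometric majorant; the factor 2 accounts for their difference.
    refine SeqL2.tendsto_of_dominated
      (b := Function.extend ι (fun j => 2 * (1 + M) * (sobWeight L s (ι j) * ρ ^ j.natAbs)) 0)
      ?_ (fun n => ?_) ?_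
    · rw [← hι.summable_iff fun n hn => by rw [Function.extend_apply' _ _ _ hn]; simp]
      refine (hgeom.mul_left ((2 * (1 + M)) ^ 2)).congr fun j => ?_
      rw [Function.comp_apply, hι.extend_apply, ← mul_pow]
    · simp only [SeqL2.mk_apply]
      by_cases hn : n ∈ range ι
      · obtain ⟨j, rfl⟩ := hn
        simp only [hdι]
        have : Continuous fun t => (sobWeight L s (ι j) * c t j : ℂ) := by
          simp only [c]
          split_ifs <;> fun_prop
        exact this.tendsto t
      · simp only [hd0 _ n hn]; exact tendsto_const_nhds
    · filter_upwards [hev] with τ hτ n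
      simp only [SeqL2.mk_apply]
      by_cases hn : n ∈ range ι
      · obtain ⟨j, rfl⟩ := hn
        rw [hdι, hdι, hι.extend_apply]
        have hw : 0 ≤ sobWeight L s (ι j) * ρ ^ j.natAbs :=
          mul_nonneg (hm.pos _).le (by positivity)
        have h1 := (hwc τ j).trans (mul_le_mul_of_nonneg_right (add_le_add_right hτ 1) hw)
        have h2 := (hwc t j).trans (mul_le_mul_of_nonneg_right
          (add_le_add_right (le_add_of_nonneg_right zero_le_one : _ ≤ M) 1) hw)
        refine (norm_sub_le _ _).trans ((add_le_add h1 h2).trans (le_of_eq (by ring)))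
      · rw [hd0 _ n hn, hd0 _ n hn, Function.extend_apply' _ _ _ hn]; simp
  · funext x
    have h := akhmediev_hasSum ha1 hk hL t x
    change _ = ∑' n, d t n / sobWeight L s n * eChar L n x
    rw [← h.tsum_eq, ← hι.tsum_eq (f := fun n => d t n / sobWeight L s n * eChar L n x)]
    · congr 1; ext j
      have : (sobWeight L s (ι j) : ℂ) ≠ 0 := by exact_mod_cast (hm.pos _).ne'
      rw [hdι, mul_div_cancel_left₀ _ this]
    · intro n hn
      by_contra hn'
      rw [Function.mem_support, hd0 t n hn'] at hn
      simp at hn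

end breather
end NLS

/-! ### Perturbed solutions as curves in the sequence space -/

namespace NLS

section perturbed
variable {a L s t₀ : ℝ} {A : ℝ → SeqL2}

/-- A perturbation of the breather is a continuous curve in the Sobolev space. -/
theorem IsPerturbedSolution.exists_curve (hL : 0 < L) (hs : 1 / 2 < s) (hA : Continuous A)
    (hAs : ∀ t, akhmediev a t = synth L (sobWeight L s) (A t)) {J : Set ℝ} {u : ℝ → ℝ → ℂ}
    (hu : IsPerturbedSolution a L s J u) :
    ∃ X : ℝ → SeqL2, ContinuousOn X J ∧
      ∀ t ∈ J, u t =ᵐ[volume] synth L (sobWeight L s) (X t) := by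
  classical
  have hm := algWeight_sobWeight hL hs
  have h : ∀ t : ℝ, ∃ W : SeqL2, t ∈ J →
      u t - akhmediev a t =ᵐ[volume] synth L (sobWeight L s) W := fun t => by
    by_cases ht : t ∈ J
    · obtain ⟨W, hW⟩ := (hu.memHs t ht).exists_ae_eq_synth hL hs
      exact ⟨W, fun _ => hW⟩
    · exact ⟨0, fun h => absurd h ht⟩
  choose W hW using h
  have hWc : ContinuousOn W J := fun t ht => by
    rw [ContinuousWithinAt, tendsto_iff_norm_sub_tendsto_zero]
    refine (hu.continuous t ht).congr' ?_
    filter_upwards [self_mem_nhdsWithin] with τ hτ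
    refine hsNorm_of_ae_eq_synth hL hs ?_
    rw [synth_sub hm]
    exact (hW τ hτ).sub (hW t ht)
  -- The sum W + A is written as a difference so that `synth_sub` applies.
  refine ⟨fun t => W t - (-A t), hWc.sub hA.neg.continuousOn, fun t ht => ?_⟩
  have hz : synth L (sobWeight L s) (-A t) = -synth L (sobWeight L s) (A t) := by
    rw [← zero_sub (A t), synth_sub hm]
    funext x; simp [synth]
  rw [synth_sub hm, hz, ← hAs]
  filter_upwards [hW t ht] with x hx
  simp only [Pi.sub_apply, Pi.neg_apply] at hx ⊢
  rw [← hx]; ring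

theorem IsPerturbedSolution.mono {J J' : Set ℝ} {u : ℝ → ℝ → ℂ}
    (hu : IsPerturbedSolution a L s J u) (h : J' ⊆ J) : IsPerturbedSolution a L s J' u where
  memHs t ht := hu.memHs t (h ht)
  continuous t ht := (hu.continuous t (h ht)).mono_left (nhdsWithin_mono t h)
  solves := hu.solves.mono h

/-- A continuous curve in the Sobolev space which solves the equation is a perturbed solution. -/
theorem isPerturbedSolution_of_curve (hL : 0 < L) (hs : 1 / 2 < s) (hA : Continuous A)
    (hAs : ∀ t, akhmediev a t = synth L (sobWeight L s) (A t)) {J : Set ℝ} {X : ℝ → SeqL2}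
    (hX : ContinuousOn X J) (hsol : SolvesNLSOn L J (fun t => synth L (sobWeight L s) (X t))) :
    IsPerturbedSolution a L s J (fun t => synth L (sobWeight L s) (X t)) where
  memHs t _ := by
    rw [hAs, ← synth_sub (algWeight_sobWeight hL hs)]
    exact memHs_synth hL hs _
  continuous t ht := by
    have hm := algWeight_sobWeight hL hs
    have h : ContinuousOn (fun t => X t - A t) J := hX.sub hA.continuousOn
    refine (tendsto_iff_norm_sub_tendsto_zero.1 (h t ht)).congr fun τ => ?_
    simp only [hAs, ← synth_sub hm]
    exact (hsNorm_of_ae_eq_synth hL hs (ae_eq_refl _)).symm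
  solves := hsol

theorem eq_of_synth_ae_eq {m : ℤ → ℝ} (hL : L ≠ 0) (hm : AlgWeight m) {x y : SeqL2}
    (h : synth L m x =ᵐ[volume] synth L m y) : x = y := by
  apply SeqL2.ext
  intro n
  have := fourierCoef_congr (L := L) h n
  have hn : (m n : ℂ) ≠ 0 := by exact_mod_cast (hm.pos n).ne'
  rwa [fourierCoef_synth hL hm, fourierCoef_synth hL hm, div_left_inj' hn] at this

theorem IsPerturbedSolution.ae_eq (hL : 0 < L) (hs : 1 / 2 < s) (hA : Continuous A)
    (hAs : ∀ t, akhmediev a t = synth L (sobWeight L s) (A t)) {J : Set ℝ}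
    (hJ : J.OrdConnected) (ht₀ : t₀ ∈ J) {u v : ℝ → ℝ → ℂ}
    (hu : IsPerturbedSolution a L s J u) (hv : IsPerturbedSolution a L s J v)
    (h : u t₀ =ᵐ[volume] v t₀) : ∀ t ∈ J, u t =ᵐ[volume] v t := by
  intro t ht
  have hm := algWeight_sobWeight hL hs
  -- Order-connectedness reduces an arbitrary `J` to the compact interval between the two times,
  -- where ODE uniqueness applies.
  have hsub : uIcc t₀ t ⊆ J := hJ.uIcc_subset ht₀ ht
  rw [uIcc] at hsub
  have hu' := hu.mono hsub
  have hv' := hv.mono hsub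
  have m0 : t₀ ∈ Icc (min t₀ t) (max t₀ t) := left_mem_uIcc
  have m1 : t ∈ Icc (min t₀ t) (max t₀ t) := right_mem_uIcc
  obtain ⟨X, hXc, hX⟩ := hu'.exists_curve hL hs hA hAs
  obtain ⟨Y, hYc, hY⟩ := hv'.exists_curve hL hs hA hAs
  have h0 : X t₀ = Y t₀ :=
    eq_of_synth_ae_eq hL.ne' hm ((hX t₀ m0).symm.trans (h.trans (hY t₀ m0)))
  have huniq := field_unique hm (t₀ := t₀) m0
    (hu'.solves.hasDerivWithinAt hm hL.ne' hXc hX)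
    (hv'.solves.hasDerivWithinAt hm hL.ne' hYc hY) (by simp only [h0]) m1
  have hXY : X t = Y t := by
    have := congrArg (rot (-phase L (t - t₀))) huniq
    simpa only [rot_neg_rot] using this
  exact (hX t m1).trans (hXY ▸ (hY t m1).symm)

end perturbed

end NLS

/-! ### Local well-posedness around the breather -/

theorem mainTheorem3 (a : ℝ) (ha0 : 0 < a) (ha1 : a < 1 / 2)
    (k : ℕ) (hk : 0 < k) (L : ℝ) (hL : L = k * (2 * Real.pi / NLS.alpha a))
    (s : ℝ) (hs : 1 / 2 < s) (t₀ : ℝ) :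
    -- existence and Lipschitz dependence, on a time interval whose length
    -- depends on the data only through a bound on their norm
    (∀ R : ℝ, 0 < R → ∃ T : ℝ, 0 < T ∧ ∃ C : ℝ, 0 < C ∧
      (∀ w₀ : ℝ → ℂ, NLS.MemHs L s w₀ → NLS.hsNorm L s w₀ ≤ R →
        ∃ u : ℝ → ℝ → ℂ,
          NLS.IsPerturbedSolution a L s (Icc (t₀ - T) (t₀ + T)) u ∧
          u t₀ =ᵐ[volume] NLS.akhmediev a t₀ + w₀) ∧
      (∀ u v : ℝ → ℝ → ℂ,
        NLS.IsPerturbedSolution a L s (Icc (t₀ - T) (t₀ + T)) u →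
        NLS.IsPerturbedSolution a L s (Icc (t₀ - T) (t₀ + T)) v →
        NLS.hsNorm L s (u t₀ - NLS.akhmediev a t₀) ≤ R →
        NLS.hsNorm L s (v t₀ - NLS.akhmediev a t₀) ≤ R →
        ∀ t ∈ Icc (t₀ - T) (t₀ + T),
          NLS.hsNorm L s (u t - v t) ≤ C * NLS.hsNorm L s (u t₀ - v t₀))) ∧
    -- uniqueness on every time interval containing the initial time
    (∀ J : Set ℝ, J.OrdConnected → t₀ ∈ J → ∀ u v : ℝ → ℝ → ℂ,
      NLS.IsPerturbedSolution a L s J u → NLS.IsPerturbedSolution a L s J v →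
      u t₀ =ᵐ[volume] v t₀ → ∀ t ∈ J, u t =ᵐ[volume] v t) := by
  open NLS in
  have hLpos := breather_period_pos ha1 hk hL
  have hm := algWeight_sobWeight hLpos hs
  obtain ⟨A, hA, hAs⟩ := exists_breatherSeq ha1 hk hL hs
  refine ⟨fun R hR => ?_, fun J hJ ht₀ u v hu hv h => hu.ae_eq hLpos hs hA hAs hJ ht₀ hv h⟩
  -- The flow acts on full data A(t₀) + w₀, so the radius R for w₀ is enlarged by the norm of the
  -- breather at t₀.
  obtain ⟨T, hT, α, hα, C, hC, hlip⟩ :=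
    exists_flow hm L t₀ (R := R + ‖A t₀‖) (by positivity)
  have ht₀ : t₀ ∈ Icc (t₀ - T) (t₀ + T) := ⟨by linarith, by linarith⟩
  refine ⟨T, hT, C, hC, fun w₀ hw₀ hw₀R => ?_, fun u v hu hv huR hvR t ht => ?_⟩
  · obtain ⟨W, hW⟩ := hw₀.exists_ae_eq_synth hLpos hs
    rw [hsNorm_of_ae_eq_synth hLpos hs hW] at hw₀R
    obtain ⟨h0, hd⟩ := hα (W + A t₀) ((norm_add_le _ _).trans (by linarith))
    refine ⟨fun t => synth L (sobWeight L s) (rot (-phase L (t - t₀)) (α (W + A t₀) t)),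
      isPerturbedSolution_of_curve hLpos hs hA hAs
        (continuousOn_rot_neg_phase fun t ht => (hd t ht).continuousWithinAt)
        (solvesNLSOn_of_hasDerivWithinAt hm hLpos.ne' hd), ?_⟩
    have hsub := synth_sub (L := L) hm (W + A t₀) (A t₀)
    rw [add_sub_cancel_right, ← hAs] at hsub
    simp only [sub_self, rot_neg_phase_zero, h0]
    filter_upwards [hW] with x hx
    rw [Pi.add_apply, hx, hsub, Pi.sub_apply, add_sub_cancel]
  -- Any solution with such a datum, not just the constructed one, is a flow line; its Lipschitz
  -- bound therefore passes to arbitrary solutions.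
  · have key : ∀ u : ℝ → ℝ → ℂ, IsPerturbedSolution a L s (Icc (t₀ - T) (t₀ + T)) u →
        hsNorm L s (u t₀ - akhmediev a t₀) ≤ R → ∃ x : SeqL2, ‖x‖ ≤ R + ‖A t₀‖ ∧
          ∀ t ∈ Icc (t₀ - T) (t₀ + T), u t =ᵐ[volume]
            synth L (sobWeight L s) (rot (-phase L (t - t₀)) (α x t)) := by
      intro u hu huR
      obtain ⟨X, hXc, hX⟩ := hu.exists_curve hLpos hs hA hAs
      have hn : ‖X t₀‖ ≤ R + ‖A t₀‖ := by
        rw [hsNorm_of_ae_eq_synth hLpos hs (x := X t₀ - A t₀)] at huR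
        · linarith [norm_le_norm_add_norm_sub' (X t₀) (A t₀)]
        · rw [synth_sub hm, ← hAs]
          exact (hX t₀ ht₀).sub (ae_eq_refl _)
      obtain ⟨h0, hd⟩ := hα (X t₀) hn
      refine ⟨X t₀, hn, fun τ hτ => ?_⟩
      have := field_unique hm ht₀ (hu.solves.hasDerivWithinAt hm hLpos.ne' hXc hX) hd
        (by simp [h0]) hτ
      rw [← this, rot_neg_rot]
      exact hX τ hτ
    obtain ⟨x, hxR, hx⟩ := key u hu huR
    obtain ⟨y, hyR, hy⟩ := key v hv hvR
    have hnorm : ∀ τ ∈ Icc (t₀ - T) (t₀ + T), hsNorm L s (u τ - v τ) = ‖α x τ - α y τ‖ := by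
      intro τ hτ
      -- The free flow preserves the H^s norm, so distances are the same in the interaction picture.
      rw [← norm_rot (-phase L (τ - t₀)), rot_sub]
      refine hsNorm_of_ae_eq_synth hLpos hs ?_
      rw [synth_sub hm]
      exact (hx τ hτ).sub (hy τ hτ)
    rw [hnorm t ht, hnorm t₀ ht₀, (hα x hxR).1, (hα y hyR).1]
    exact hlip x y hxR hyR t ht
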